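/- Throughout, vocabularies are countable, structures are non-empty, and an $L_{\omega_1,\omega}$-sentence is \emph{complete} if it is satisfiable and implies $\psi$ or $\neg\psi$ for every $L_{\omega_1,\omega}$-sentence $\psi$ of its vocabulary. A model of $\phi$ is \emph{maximal} if it has no proper extension that is again a model of $\phi$. For a unary predicate symbol $P$, a model $\mathcal N$ is of \emph{type} $(\kappa,\lambda)$ (with respect to $P$) if $|\mathcal N|=\kappa$ and $|P^{\mathcal N}|=\lambda$. A subset of a countable structure is a \emph{set of absolute indiscernibles} if it is infinite and every permutation of it extends to an automorphism of the structure. Let $\phi$ be a complete $L_{\omega_1,\omega}$-sentence in a vocabulary containing a unary predicate symbol $P$, and let $\kappa$ be an infinite cardinal. Then $\phi$ (with $P$) \emph{homogeneously characterizes} $\kappa$ if (a) $\phi$ has no model of size $\kappa^+$, (b) $P^{\mathcal M}$ is a set of absolute indiscernibles for the (unique) countable model $\mathcal M$ of $\phi$, and (c) $\phi$ has a maximal model of type $(\kappa,\kappa)$. A cardinal $\kappa$ is \emph{homogeneously characterizable} if some such $\phi,P$ homogeneously characterize it. A pair $(\theta,U)$ of a complete $L_{\omega_1,\omega}$-sentence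 $\theta$ and a unary predicate symbol $U$ of its vocabulary is \emph{receptive} if the vocabulary contains a unary predicate symbol $V$ and a binary relation symbol $P$ such that $\theta$ implies that $V$ and $U$ partition the universe and that $P$ is (the graph of) a function from $V$ onto $U$, and $U$ defines a set of absolute indiscernibles in the countable model of $\theta$. \textbf{Theorem.} Let $\kappa$ be a homogeneously characterizable cardinal. Then there are a countable vocabulary containing a unary predicate symbol $B$ and an $L_{\omega_1,\omega}$-sentence $\chi$ in this vocabulary such that $(\chi,B)$ is receptive, $\chi$ (with $B$) homogeneously characterizes $\kappa$, and for every infinite cardinal $\lambda\le\kappa$, $\chi$ has a maximal model of type $(\kappa,\lambda)$ with respect to $B$, that is, a maximal model $\mathcal M$ with $|\mathcal M|=\kappa$ and $|B^{\mathcal M}|=\lambda$. -/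

import Mathlib

open Cardinal

universe u

namespace LOmegaOne

open FirstOrder FirstOrder.Language


/-- Formulas of the infinitary logic `L_{ω₁,ω}` over the vocabulary `L` whose free variables are
among `x₀, …, x_{n-1}`: besides the first-order operations there are conjunctions of countable
families of formulas. In `all φ` the bound variable is the last one. Negation, (countable)
disjunction and existential quantification are the usual abbreviations. -/
inductive Formula (L : FirstOrder.Language.{0, 0}) : ℕ → Type
  | falsum {n : ℕ} : Formula L n
  | equal {n : ℕ} (s t : L.Term (Fin n)) : Formula L n
  | rel {n k : ℕ} (R : L.Relations k) (ts : Fin k → L.Term (Fin n)) : Formula L n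
  | imp {n : ℕ} (φ ψ : Formula L n) : Formula L n
  | conj {n : ℕ} (φ : ℕ → Formula L n) : Formula L n
  | all {n : ℕ} (φ : Formula L (n + 1)) : Formula L n

variable {L : FirstOrder.Language.{0, 0}}

/-- Truth of a formula in a structure under an assignment of its free variables. -/
def Formula.Realize (M : Type u) [L.Structure M] : {n : ℕ} → Formula L n → (Fin n → M) → Prop
  | _, .falsum, _ => False
  | _, .equal s t, v => s.realize v = t.realize v
  | _, .rel R ts, v => Structure.RelMap R fun i => (ts i).realize v
  | _, .imp φ ψ, v => φ.Realize M v → ψ.Realize M v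
  | _, .conj φ, v => ∀ i, (φ i).Realize M v
  | _, .all φ, v => ∀ x : M, φ.Realize M (Fin.snoc v x)

/-- Sentences of `L_{ω₁,ω}`. -/
abbrev Sentence (L : FirstOrder.Language.{0, 0}) : Type := Formula L 0

/-- `M` is a model of the sentence `φ`. Models are non-empty, as usual. -/
def IsModel (M : Type u) [L.Structure M] (φ : Sentence L) : Prop :=
  Nonempty M ∧ φ.Realize M Fin.elim0

/-- The sentence `φ` is complete: it has a model, and it implies `ψ` or the negation of `ψ`, for
every `L_{ω₁,ω}`-sentence `ψ` of the same vocabulary. -/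
def IsComplete (φ : Sentence L) : Prop :=
  (∃ (M : Type u) (_ : L.Structure M), IsModel M φ) ∧
    ∀ ψ : Sentence L,
      (∀ (M : Type u) [L.Structure M], IsModel M φ → IsModel M ψ) ∨
      (∀ (M : Type u) [L.Structure M], IsModel M φ → ¬ IsModel M ψ)

/-- The set defined by the unary predicate symbol `P` in `M`. -/
def predSet (P : L.Relations 1) (M : Type u) [L.Structure M] : Set M :=
  {x | Structure.RelMap P ![x]}

/-- `S` is a set of absolute indiscernibles for the `L`-structure `M`: it is infinite and every
permutation of `S` extends to an automorphism of `M`. -/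
def IsAbsolutelyIndiscernible (L : FirstOrder.Language.{0, 0}) {M : Type u} [L.Structure M]
    (S : Set M) : Prop :=
  S.Infinite ∧ ∀ σ : Equiv.Perm S, ∃ g : M ≃[L] M, ∀ x : S, g x = σ x

/-- `P` defines a set of absolute indiscernibles in the countable model of `φ`. (This is used for
complete sentences `φ`; their countable model is unique up to isomorphism.) -/
def IndiscernibleInCountableModel (φ : Sentence L) (P : L.Relations 1) : Prop :=
  ∃ (M : Type u) (_ : L.Structure M),
    Countable M ∧ IsModel M φ ∧ IsAbsolutelyIndiscernible L (predSet P M)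

/-- `M` is a maximal model of `φ`: it is a model of `φ` without a proper extension that is a model
of `φ`. -/
def IsMaximalModel (M : Type u) [L.Structure M] (φ : Sentence L) : Prop :=
  IsModel M φ ∧
    ∀ (N : Type u) [L.Structure N], IsModel N φ → ∀ f : M ↪[L] N, Function.Surjective f

/-- `M` is of type `(κ, μ)` with respect to the unary predicate symbol `P`. -/
def IsOfType (M : Type u) [L.Structure M] (P : L.Relations 1) (κ μ : Cardinal.{u}) : Prop :=
  #M = κ ∧ #(predSet P M) = μ

/-- `φ` homogeneously characterizes the infinite cardinal `κ`, with the predicate symbol `P`. -/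
structure HomogeneouslyCharacterizes (φ : Sentence L) (P : L.Relations 1)
    (κ : Cardinal.{u}) : Prop where
  aleph0_le : ℵ₀ ≤ κ
  complete : IsComplete.{u} φ
  no_larger : ¬ ∃ (M : Type u) (_ : L.Structure M), IsModel M φ ∧ #M = Order.succ κ
  indiscernible : IndiscernibleInCountableModel.{u} φ P
  maximal : ∃ (M : Type u) (_ : L.Structure M), IsMaximalModel M φ ∧ IsOfType M P κ κ

/-- `κ` is homogeneously characterizable: some sentence of `L_{ω₁,ω}` in a countable vocabulary
homogeneously characterizes it. -/
def HomogeneouslyCharacterizable (κ : Cardinal.{u}) : Prop :=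
  ∃ (L : FirstOrder.Language.{0, 0}) (φ : Sentence L) (P : L.Relations 1),
    Countable L.Symbols ∧ HomogeneouslyCharacterizes φ P κ

/-- In `M`, the predicates `V` and `U` partition the universe and the binary relation `p` is (the
graph of) a projection of `V` onto `U`, that is, a function from `V` onto `U`. -/
structure IsProjection (M : Type u) [L.Structure M] (V U : L.Relations 1)
    (p : L.Relations 2) : Prop where
  isCompl : IsCompl (predSet V M) (predSet U M)
  subset : ∀ x y : M, Structure.RelMap p ![x, y] → x ∈ predSet V M ∧ y ∈ predSet U M
  function : ∀ x ∈ predSet V M, ∃! y : M, Structure.RelMap p ![x, y]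
  onto : ∀ y ∈ predSet U M, ∃ x : M, Structure.RelMap p ![x, y]

/-- The pair `(θ, U)` is receptive: `θ` is complete; for some further predicate symbols `V`, `p` of
the vocabulary, `θ` implies that `V`, `U` partition the universe and `p` is a projection of `V` onto
`U`; and `U` defines an infinite absolutely indiscernible set in the countable model of `θ`. -/
structure IsReceptive (θ : Sentence L) (U : L.Relations 1) : Prop where
  complete : IsComplete.{u} θ
  projection : ∃ (V : L.Relations 1) (p : L.Relations 2),
    ∀ (M : Type u) [L.Structure M], IsModel M θ → IsProjection M V U p
  indiscernible : IndiscernibleInCountableModel.{u} θ U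

end LOmegaOne

/-! Let `φ`, `P` homogeneously characterize `κ`. The models of the new sentence `χ` are, up to
isomorphism, the structures `(N × B) ⊔ B` where `N` is a model of `φ`, `B` is an infinite set
without structure, and a labelling sends `P^N` to `B` with every fibre infinite. The new predicate
is the copy of `B`, and the projection of pairs to their second coordinate gives the receptive
shape. The product alone would leave `B` free to grow; the labelling ties `B` to `N`.

Sizes. Each label has a nonempty fibre, so `|B| ≤ |N|` and the product has size `|N|`; a model of
size `κ⁺` would give one of `φ`. Conversely, a set `B` of any infinite size at most `|P^N|` admits a
labelling (`exists_isLabelling`), so a maximal model of `φ` of type `(κ, κ)` yields all the required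
types.

Maximality (`LabProd.surjective_of_isMaximalModel`). An embedding of products induces an embedding
of the first factors, which is onto when `N` is maximal. Then no new labels can appear either,
because every label is the label of some element of the first factor.

Indiscernibility and completeness both rest on `IsLabelling.exists_equiv`. In countable models all
fibres are countably infinite, so a bijection of labels lifts to a bijection of the sets defined by
`P`; absolute indiscernibility of `P` extends it to an isomorphism. With equal factors this extends
each permutation of `B`; in general it shows that `χ` has a single countable model. By downward
Löwenheim–Skolem (`exists_countable_model`), any sentence consistent with `χ` holds in that model,
so `χ` is complete. The uniqueness of the countable model of `φ` itself is Scott's back-and-forth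
argument (`IsComplete.nonempty_equiv`).

That `χ` is a sentence of the logic comes from axioms for the product structure
(`IsProductLike.exists_equiv_labProd`) together with a translation of `φ` to first coordinates
(`realize_translate`). -/

namespace LOmegaOne

open FirstOrder FirstOrder.Language

variable {L : FirstOrder.Language.{0, 0}}

/-! ### Derived connectives of the infinitary logic and their semantics. -/

namespace Formula

variable {M : Type u} [L.Structure M] {n : ℕ}

def neg (φ : Formula L n) : Formula L n := .imp φ .falsum

def and (φ ψ : Formula L n) : Formula L n := neg (.imp φ (neg ψ))

def ex (φ : Formula L (n + 1)) : Formula L n := neg (.all (neg φ))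

/-- The conjunction of a countable family of formulas. -/
noncomputable def iAnd {ι : Type*} [Countable ι] (φ : ι → Formula L n) : Formula L n :=
  letI := Encodable.ofCountable ι
  .conj fun j => (Encodable.decode (α := ι) j).elim (neg .falsum) φ

/-- The disjunction of a countable family of formulas. -/
noncomputable def iOr {ι : Type*} [Countable ι] (φ : ι → Formula L n) : Formula L n :=
  neg (iAnd fun i => neg (φ i))

/-- The universal closure of a formula. -/
def alls : {n : ℕ} → Formula L n → Sentence L
  | 0, φ => φ
  | _ + 1, φ => alls (.all φ)

/-- Existential quantification over the last `k` variables. -/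
def exs : (k : ℕ) → Formula L (n + k) → Formula L n
  | 0, φ => φ
  | k + 1, φ => exs k (.ex φ)

/-- The atomic formula given by a relation symbol applied to variables. -/
def atom {k : ℕ} (R : L.Relations k) (g : Fin k → Fin n) : Formula L n :=
  .rel R fun i => .var (g i)

/-- Equality of two variables. -/
def eqv (i j : Fin n) : Formula L n := .equal (.var i) (.var j)

variable (φ ψ : Formula L n) (v : Fin n → M)

@[simp] lemma realize_falsum : (falsum : Formula L n).Realize M v ↔ False := Iff.rfl

@[simp] lemma realize_imp : (imp φ ψ).Realize M v ↔ (φ.Realize M v → ψ.Realize M v) := Iff.rfl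

@[simp] lemma realize_conj (φ : ℕ → Formula L n) :
    (conj φ).Realize M v ↔ ∀ i, (φ i).Realize M v := Iff.rfl

@[simp] lemma realize_all (φ : Formula L (n + 1)) :
    (all φ).Realize M v ↔ ∀ x : M, φ.Realize M (Fin.snoc v x) := Iff.rfl

@[simp] lemma realize_neg : (neg φ).Realize M v ↔ ¬ φ.Realize M v := Iff.rfl

@[simp] lemma realize_and : (and φ ψ).Realize M v ↔ φ.Realize M v ∧ ψ.Realize M v := by
  simp [and]

@[simp] lemma realize_ex (φ : Formula L (n + 1)) :
    (ex φ).Realize M v ↔ ∃ x : M, φ.Realize M (Fin.snoc v x) := by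
  simp [ex]

@[simp] lemma realize_iAnd {ι : Type*} [Countable ι] (φ : ι → Formula L n) :
    (iAnd φ).Realize M v ↔ ∀ i, (φ i).Realize M v := by
  let := Encodable.ofCountable ι
  rw [iAnd, realize_conj]
  constructor
  · intro h i
    simpa using h (Encodable.encode i)
  · intro h j
    change ((Encodable.decode (α := ι) j).elim (neg .falsum) φ).Realize M v
    rcases Encodable.decode (α := ι) j with _ | i
    · exact id
    · exact h i

@[simp] lemma realize_iOr {ι : Type*} [Countable ι] (φ : ι → Formula L n) :
    (iOr φ).Realize M v ↔ ∃ i, (φ i).Realize M v := by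
  simp [iOr]

lemma realize_atom {k : ℕ} (R : L.Relations k) (g : Fin k → Fin n) :
    (atom R g).Realize M v ↔ Structure.RelMap R fun i => v (g i) := Iff.rfl

@[simp] lemma realize_atom_one (R : L.Relations 1) (i : Fin n) :
    (atom R ![i]).Realize M v ↔ Structure.RelMap R ![v i] := by
  rw [realize_atom]
  congr! with k
  fin_cases k
  rfl

@[simp] lemma realize_atom_two (R : L.Relations 2) (i j : Fin n) :
    (atom R ![i, j]).Realize M v ↔ Structure.RelMap R ![v i, v j] := by
  rw [realize_atom]
  congr! with k
  fin_cases k <;> rfl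

@[simp] lemma realize_eqv (i j : Fin n) :
    (eqv i j : Formula L n).Realize M v ↔ v i = v j := Iff.rfl

lemma realize_alls : ∀ {n : ℕ} (φ : Formula L n) (v₀ : Fin 0 → M),
    (alls φ).Realize M v₀ ↔ ∀ v : Fin n → M, φ.Realize M v
  | 0, φ, v₀ => by
    refine ⟨fun h v => ?_, fun h => h v₀⟩
    rwa [Subsingleton.elim v v₀]
  | n + 1, φ, v₀ => by
    rw [alls, realize_alls]
    refine ⟨fun h v => ?_, fun h v x => h _⟩
    simpa using h (Fin.init v) (v (Fin.last n))

lemma realize_exs : ∀ (k : ℕ) (φ : Formula L (n + k)) (v : Fin n → M),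
    (exs k φ).Realize M v ↔ ∃ w : Fin k → M, φ.Realize M (Fin.append v w)
  | 0, φ, v => by
    rw [exs]
    refine ⟨fun h => ⟨Fin.elim0, by simpa using h⟩, fun ⟨w, h⟩ => ?_⟩
    rw [Subsingleton.elim w Fin.elim0] at h
    simpa using h
  | k + 1, φ, v => by
    rw [exs, realize_exs]
    simp only [realize_ex]
    constructor
    · rintro ⟨w, x, h⟩
      exact ⟨Fin.snoc w x, by rwa [Fin.append_snoc]⟩
    · rintro ⟨w, h⟩
      refine ⟨Fin.init w, w (Fin.last k), ?_⟩
      rwa [← Fin.append_snoc, Fin.snoc_init_self]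

/-- Isomorphic structures satisfy the same formulas. -/
lemma realize_equiv {N : Type u} [L.Structure N] (g : M ≃[L] N) :
    ∀ {n : ℕ} (φ : Formula L n) (v : Fin n → M),
      φ.Realize N (g ∘ v) ↔ φ.Realize M v := by
  intro n φ
  induction φ with
  | falsum => intro v; rfl
  | equal s t =>
    intro v
    simp only [Realize, HomClass.realize_term, g.injective.eq_iff]
  | rel R ts =>
    intro v
    simp only [Realize, HomClass.realize_term]
    exact StrongHomClass.map_rel g R _
  | imp φ ψ h₁ h₂ => intro v; simp only [realize_imp, h₁, h₂]
  | conj φ h => intro v; simp only [realize_conj, h]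
  | all φ h =>
    intro v
    simp only [realize_all]
    rw [← g.toEquiv.forall_congr_right]
    refine forall_congr' fun x => ?_
    rw [← h, Fin.comp_snoc]
    rfl

end Formula

lemma IsModel.of_equiv {M N : Type u} [L.Structure M] [L.Structure N] {φ : Sentence L}
    (h : IsModel M φ) (g : M ≃[L] N) : IsModel N φ := by
  refine ⟨h.1.map g, ?_⟩
  rw [Subsingleton.elim Fin.elim0 (g ∘ Fin.elim0), Formula.realize_equiv]
  exact h.2

lemma IsComplete.realize_of_realize {φ : Sentence L} (hφ : IsComplete.{u} φ)
    {M N : Type u} [L.Structure M] [L.Structure N] (hM : IsModel M φ) (hN : IsModel N φ)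
    {ψ : Sentence L} (h : ψ.Realize M Fin.elim0) : ψ.Realize N Fin.elim0 := by
  rcases hφ.2 ψ with h' | h'
  · exact (h' N hN).2
  · exact absurd ⟨hM.1, h⟩ (h' M hM)

/-! ### Back-and-forth: uniqueness of the countable model of a complete sentence. -/

section Scott

/-- The tuples `v` and `w` satisfy the same `L_{ω₁,ω}`-formulas. -/
def SameType {M N : Type u} [L.Structure M] [L.Structure N] {n : ℕ} (v : Fin n → M)
    (w : Fin n → N) : Prop :=
  ∀ φ : Formula L n, φ.Realize M v ↔ φ.Realize N w

variable {M N : Type u} [L.Structure M] [L.Structure N] {n : ℕ}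

lemma SameType.symm {v : Fin n → M} {w : Fin n → N} (h : SameType (L := L) v w) :
    SameType (L := L) w v := fun φ => (h φ).symm

lemma sameType_of_imp {v : Fin n → M} {w : Fin n → N}
    (h : ∀ φ : Formula L n, φ.Realize M v → φ.Realize N w) : SameType (L := L) v w :=
  fun φ => ⟨h φ, fun hw => by_contra fun hv => h φ.neg hv hw⟩

/-- In a countable structure, every type realized is isolated by a single formula. -/
lemma exists_isolating [Countable M] (v : Fin n → M) :
    ∃ θ : Formula L n, θ.Realize M v ∧ ∀ w : Fin n → M, θ.Realize M w → SameType (L := L) v w := by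
  have h : ∀ w : {w : Fin n → M // ¬ SameType (L := L) v w},
      ∃ ψ : Formula L n, ψ.Realize M v ∧ ¬ ψ.Realize M w.1 := by
    intro w
    by_contra! hw
    exact w.2 (sameType_of_imp hw)
  choose ψ h₁ h₂ using h
  refine ⟨.iAnd ψ, by simpa using fun w hw => h₁ ⟨w, hw⟩, fun w hw => ?_⟩
  by_contra hvw
  exact h₂ ⟨w, hvw⟩ ((Formula.realize_iAnd _ _).1 hw _)

/-- A formula isolating a type in one model of a complete sentence isolates it in all models. -/
lemma IsComplete.sameType_of_isolating {φ : Sentence L} (hφ : IsComplete.{u} φ)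
    (hM : IsModel M φ) (hN : IsModel N φ) {θ : Formula L n} {v : Fin n → M}
    (hθ : ∀ w : Fin n → M, θ.Realize M w → SameType (L := L) v w) {w : Fin n → N}
    (hw : θ.Realize N w) : SameType (L := L) v w := by
  refine sameType_of_imp fun ψ hψ => ?_
  have h : (Formula.alls (.imp θ ψ)).Realize M Fin.elim0 :=
    (Formula.realize_alls _ _).2 fun x hx => (hθ x hx ψ).1 hψ
  exact (Formula.realize_alls _ _).1 (hφ.realize_of_realize hM hN h) w hw

/-- The one-point extension step. If `θ` isolates the type of the extended tuple, then `∃ θ` belongs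
to the type of `v` and hence of `w`; completeness carries the isolating property of `θ` over to `N`,
so any witness there has the right type. -/
lemma IsComplete.exists_sameType_snoc [Countable M] {φ : Sentence L} (hφ : IsComplete.{u} φ)
    (hM : IsModel M φ) (hN : IsModel N φ) {v : Fin n → M} {w : Fin n → N}
    (h : SameType (L := L) v w) (x : M) :
    ∃ y : N, SameType (L := L) (Fin.snoc v x : Fin (n + 1) → M) (Fin.snoc w y : Fin (n + 1) → N) := by
  obtain ⟨θ, h₁, h₂⟩ := exists_isolating (L := L) (Fin.snoc v x : Fin (n + 1) → M)
  obtain ⟨y, hy⟩ := (Formula.realize_ex _ _).1 ((h θ.ex).1 ((Formula.realize_ex _ _).2 ⟨x, h₁⟩))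
  exact ⟨y, hφ.sameType_of_isolating hM hN h₂ hy⟩

/-- The finite partial maps between two structures preserving all formulas, as enumerated graphs. -/
structure PartialMap (L : FirstOrder.Language.{0, 0}) (M N : Type u) [L.Structure M]
    [L.Structure N] where
  size : ℕ
  left : Fin size → M
  right : Fin size → N
  sameType : SameType (L := L) left right

namespace PartialMap

def graph (s : PartialMap L M N) : Set (M × N) := Set.range fun i => (s.left i, s.right i)

instance : Preorder (PartialMap L M N) := Preorder.lift graph

/-- The extension of a partial map by one pair. -/
def snoc (s : PartialMap L M N) (x : M) (y : N)
    (h : SameType (L := L) (Fin.snoc s.left x : Fin (s.size + 1) → M)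
      (Fin.snoc s.right y : Fin (s.size + 1) → N)) : PartialMap L M N :=
  ⟨s.size + 1, Fin.snoc s.left x, Fin.snoc s.right y, h⟩

lemma le_snoc (s : PartialMap L M N) (x : M) (y : N) (h) : s ≤ s.snoc x y h := by
  rintro _ ⟨i, rfl⟩
  exact ⟨i.castSucc, by simp [snoc]⟩

lemma mem_snoc (s : PartialMap L M N) (x : M) (y : N) (h) : (x, y) ∈ (s.snoc x y h).graph :=
  ⟨Fin.last _, by simp [snoc]⟩

/-- A relation that is directed union of partial maps, total and onto, is an isomorphism. -/
lemma exists_equiv {I : Set (PartialMap L M N)} (hne : I.Nonempty) (hI : DirectedOn (· ≤ ·) I)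
    (htot : ∀ x, ∃ s ∈ I, ∃ y, (x, y) ∈ s.graph) (honto : ∀ y, ∃ s ∈ I, ∃ x, (x, y) ∈ s.graph) :
    Nonempty (M ≃[L] N) := by
  -- By directedness, finitely many related pairs already lie in one partial map, so every formula
  -- about them transfers.
  have fin : ∀ {k : ℕ} (x : Fin k → M) (y : Fin k → N), (∀ i, ∃ s ∈ I, (x i, y i) ∈ s.graph) →
      ∃ s ∈ I, ∃ g : Fin k → Fin s.size, (∀ i, x i = s.left (g i)) ∧ ∀ i, y i = s.right (g i) := by
    intro k x y h
    choose s hs hxy using h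
    have : Nonempty I := hne.to_subtype
    obtain ⟨⟨t, ht⟩, hst⟩ := (directedOn_iff_directed.1 hI).finite_le fun i => (⟨s i, hs i⟩ : I)
    have : ∀ i, ∃ j, (t.left j, t.right j) = (x i, y i) := fun i => hst i (hxy i)
    choose g hg using this
    exact ⟨t, ht, g, fun i => (congrArg Prod.fst (hg i)).symm, fun i => (congrArg Prod.snd (hg i)).symm⟩
  choose sf hsf F hF using htot
  choose sg hsg G hG using honto
  have uniq : ∀ {x x' : M} {y y' : N}, (∃ s ∈ I, (x, y) ∈ s.graph) →
      (∃ s ∈ I, (x', y') ∈ s.graph) → (x = x' ↔ y = y') := by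
    intro x x' y y' h h'
    obtain ⟨s, -, g, hx, hy⟩ := fin ![x, x'] ![y, y'] (by
      intro i
      fin_cases i
      · exact h
      · exact h')
    have hs := s.sameType (Formula.eqv (g 0) (g 1))
    simp only [Formula.realize_eqv, ← hx, ← hy] at hs
    exact hs
  have hR : ∀ x, ∃ s ∈ I, (x, F x) ∈ s.graph := fun x => ⟨sf x, hsf x, hF x⟩
  have hR' : ∀ y, ∃ s ∈ I, (G y, y) ∈ s.graph := fun y => ⟨sg y, hsg y, hG y⟩
  refine ⟨⟨⟨F, G, fun x => ?_, fun y => ?_⟩, fun {k} f x => ?_, fun {k} R x => ?_⟩⟩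
  · exact (uniq (hR' (F x)) (hR x)).2 rfl
  · exact (uniq (hR (G y)) (hR' y)).1 rfl
  · obtain ⟨s, -, g, hx, hy⟩ := fin (Fin.snoc x (Structure.funMap f x) : Fin (k + 1) → M)
      (F ∘ Fin.snoc x (Structure.funMap f x)) (fun i => hR _)
    -- With the value appended to the tuple of arguments, preservation of `f` becomes the transfer
    -- of an atomic equation.
    have hs := s.sameType (.equal (.func f fun i => .var (g i.castSucc)) (.var (g (Fin.last k))))
    simp only [Formula.Realize, Term.realize_func, Term.realize_var, ← hx, ← hy, Fin.snoc_castSucc,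
      Fin.snoc_last, true_iff, Function.comp_apply] at hs
    exact hs.symm
  · obtain ⟨s, -, g, hx, hy⟩ := fin x (F ∘ x) (fun i => hR _)
    have hs := s.sameType (Formula.atom R g)
    simp only [Formula.realize_atom, ← hx, ← hy] at hs
    exact hs.symm

end PartialMap

/-- Countable models of a complete sentence are isomorphic. -/
theorem IsComplete.nonempty_equiv [Countable M] [Countable N] {φ : Sentence L}
    (hφ : IsComplete.{u} φ) (hM : IsModel M φ) (hN : IsModel N φ) : Nonempty (M ≃[L] N) := by
  let := Encodable.ofCountable (M ⊕ N)
  let D : M ⊕ N → Order.Cofinal (PartialMap L M N) := Sum.elim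
    (fun x => ⟨{s | ∃ y, (x, y) ∈ s.graph}, fun s => by
      obtain ⟨y, hy⟩ := hφ.exists_sameType_snoc hM hN s.sameType x
      exact ⟨_, ⟨y, s.mem_snoc x y hy⟩, s.le_snoc x y hy⟩⟩)
    (fun y => ⟨{s | ∃ x, (x, y) ∈ s.graph}, fun s => by
      obtain ⟨x, hx⟩ := hφ.exists_sameType_snoc hN hM s.sameType.symm y
      exact ⟨_, ⟨x, s.mem_snoc x y hx.symm⟩, s.le_snoc x y hx.symm⟩⟩)
  -- Completeness is exactly what makes the empty map preserve all formulas. A directed family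
  -- meeting the countably many cofinal sets `D` is then total and onto.
  let s₀ : PartialMap L M N := ⟨0, Fin.elim0, Fin.elim0, sameType_of_imp fun ψ hψ =>
    hφ.realize_of_realize hM hN hψ⟩
  refine PartialMap.exists_equiv (I := Order.idealOfCofinals s₀ D) (Order.Ideal.nonempty _)
    (Order.Ideal.directed _) (fun x => ?_) fun y => ?_
  · obtain ⟨s, hs, hI⟩ := Order.cofinal_meets_idealOfCofinals s₀ D (.inl x)
    exact ⟨s, hI, hs⟩
  · obtain ⟨s, hs, hI⟩ := Order.cofinal_meets_idealOfCofinals s₀ D (.inr y)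
    exact ⟨s, hI, hs⟩

end Scott

/-! ### Downward Löwenheim–Skolem. -/

section LowenheimSkolem

variable {M : Type u} [L.Structure M]

/-- For every formula there is a countable-valued closure operator such that the formula is absolute
between the structure and its substructures closed under the operator. -/
lemma exists_closure_absolute [Nonempty M] {n : ℕ} (φ : Formula L n) :
    ∃ cl : Finset M → Set M, (∀ F, (cl F).Countable) ∧
      ∀ S : L.Substructure M, (∀ F : Finset M, (F : Set M) ⊆ S → cl F ⊆ S) →
        ∀ v : Fin n → S, φ.Realize S v ↔ φ.Realize M fun i => (v i : M) := by
  induction φ with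
  | falsum => exact ⟨fun _ => ∅, by simp, fun _ _ _ => Iff.rfl⟩
  | equal s t =>
    refine ⟨fun _ => ∅, by simp, fun S _ v => ?_⟩
    have h : ∀ t : L.Term (Fin _), S.subtype (t.realize v) = t.realize (fun i => (v i : M)) := fun t =>
      (HomClass.realize_term S.subtype).symm
    simp only [Formula.Realize, ← h, S.subtype.injective.eq_iff]
  | rel R ts =>
    refine ⟨fun _ => ∅, by simp, fun S _ v => ?_⟩
    have h : ∀ t : L.Term (Fin _), S.subtype (t.realize v) = t.realize (fun i => (v i : M)) := fun t =>
      (HomClass.realize_term S.subtype).symm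
    simp only [Formula.Realize, ← h]
    exact (StrongHomClass.map_rel S.subtype R _).symm
  | imp φ ψ h₁ h₂ =>
    obtain ⟨c₁, hc₁, h₁⟩ := h₁
    obtain ⟨c₂, hc₂, h₂⟩ := h₂
    refine ⟨fun F => c₁ F ∪ c₂ F, fun F => (hc₁ F).union (hc₂ F), fun S hS v => ?_⟩
    simp only [Set.union_subset_iff] at hS
    rw [Formula.realize_imp, Formula.realize_imp, h₁ S fun F hF => (hS F hF).1,
      h₂ S fun F hF => (hS F hF).2]
  | conj φ h =>
    choose c hc h using h
    refine ⟨fun F => ⋃ i, c i F, fun F => Set.countable_iUnion fun i => hc i F, fun S hS v => ?_⟩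
    simp only [Set.iUnion_subset_iff] at hS
    simp only [Formula.realize_conj]
    exact forall_congr' fun i => h i S (fun F hF => hS F hF i) v
  | @all n φ h =>
    obtain ⟨c, hc, h⟩ := h
    -- A Skolem function for the universal quantifier: the chosen element is a counterexample
    -- whenever there is one, so testing `φ` at it decides the quantified formula.
    have hw : ∀ v : Fin n → M, ∃ x : M, φ.Realize M (Fin.snoc v x) → φ.all.Realize M v := by
      intro v
      by_cases hv : φ.all.Realize M v
      · exact ⟨Classical.arbitrary M, fun _ => hv⟩
      · obtain ⟨x, hx⟩ := not_forall.1 hv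
        exact ⟨x, fun h => absurd h hx⟩
    choose w hw using hw
    refine ⟨fun F => c F ∪ Set.range fun v : Fin n → F => w fun i => v i,
      fun F => (hc F).union (Set.countable_range _), fun S hS v => ?_⟩
    simp only [Set.union_subset_iff] at hS
    have hsnoc : ∀ x : S, (fun i => ((Fin.snoc v x : Fin (n + 1) → S) i : M)) =
        Fin.snoc (fun i => (v i : M)) (x : M) := fun x =>
      Fin.comp_snoc (Subtype.val : S → M) v x
    simp only [Formula.realize_all, h S fun F hF => (hS F hF).1, hsnoc]
    refine ⟨fun hv => hw _ ?_, fun hv x => hv x⟩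
    classical
    have hmem : w (fun i => (v i : M)) ∈ S := by
      refine (hS (Finset.univ.image fun i => (v i : M)) ?_).2
        ⟨fun i => ⟨v i, Finset.mem_image_of_mem _ (Finset.mem_univ i)⟩, rfl⟩
      simp only [Finset.coe_image, Finset.coe_univ, Set.image_univ]
      rintro _ ⟨i, rfl⟩
      exact (v i).2
    exact hv ⟨_, hmem⟩

/-- A nonempty countable set closed under a countable-valued operator on finite sets exists. -/
lemma exists_countable_closed {X : Type u} [Nonempty X] (cl : Finset X → Set X)
    (hcl : ∀ F, (cl F).Countable) :
    ∃ S : Set X, S.Countable ∧ S.Nonempty ∧ ∀ F : Finset X, (F : Set X) ⊆ S → cl F ⊆ S := by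
  let T : ℕ → Set X := fun n =>
    Nat.rec {Classical.arbitrary X} (fun _ A => A ∪ ⋃ F ∈ {F : Finset X | (F : Set X) ⊆ A}, cl F) n
  have hT : ∀ n, T (n + 1) = T n ∪ ⋃ F ∈ {F : Finset X | (F : Set X) ⊆ T n}, cl F := fun n => rfl
  have hmono : Monotone T := monotone_nat_of_le_succ fun n => by
    rw [hT]
    exact Set.subset_union_left
  have hcount : ∀ n, (T n).Countable := by
    intro n
    induction n with
    | zero => exact Set.countable_singleton _
    | succ n ih =>
      rw [hT]
      have hF : {F : Finset X | (F : Set X) ⊆ T n}.Countable :=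
        ((Set.countable_ofPred_finite_subset ih).preimage Finset.coe_injective).mono fun F hF => by
          exact ⟨F.finite_toSet, hF⟩
      exact ih.union (hF.biUnion fun F _ => hcl F)
  refine ⟨⋃ n, T n, Set.countable_iUnion hcount,
    ⟨Classical.arbitrary X, Set.mem_iUnion.2 ⟨0, rfl⟩⟩, fun F hF => ?_⟩
  obtain ⟨n, hn⟩ : ∃ n, (F : Set X) ⊆ T n :=
    (hmono.directed_le).exists_mem_subset_of_finset_subset_biUnion hF
  refine subset_trans ?_ (Set.subset_iUnion T (n + 1))
  rw [hT]
  exact (Set.subset_biUnion_of_mem (u := fun F => cl F)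
    (show F ∈ {F : Finset X | (F : Set X) ⊆ T n} from hn)).trans Set.subset_union_right

/-- The downward Löwenheim–Skolem theorem for a sentence of `L_{ω₁,ω}` in a relational vocabulary. -/
theorem exists_countable_model [L.IsRelational] {φ : Sentence L} (h : IsModel M φ) :
    ∃ (N : Type u) (_ : L.Structure N), Countable N ∧ IsModel N φ := by
  have := h.1
  obtain ⟨cl, hcl, habs⟩ := exists_closure_absolute (M := M) φ
  obtain ⟨S, hc, hne, hS⟩ := exists_countable_closed cl hcl
  -- There are no function symbols, so every subset is a substructure.
  let S' : L.Substructure M := ⟨S, fun f => isEmptyElim f⟩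
  refine ⟨S', inferInstance, hc.to_subtype, hne.to_subtype, (habs S' hS Fin.elim0).2 ?_⟩
  convert h.2

end LowenheimSkolem

/-! ### The product vocabulary and labelled products. -/

/-- The symbols of `L`, made relational: function symbols are replaced by their graphs. -/
inductive BaseSym (L : FirstOrder.Language.{0, 0}) : ℕ → Type
  | rel {k : ℕ} (R : L.Relations k) : BaseSym L k
  | graph {k : ℕ} (f : L.Functions k) : BaseSym L (k + 1)

/-- The relation symbols of the product vocabulary: `pt` and `idx` for the two sorts, `proj` for the
projection to the second coordinate, `same` for equality of first coordinates, `lab` for the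
labelling of points by indices, and the relational version of the symbols of `L`. -/
inductive ProdRel (L : FirstOrder.Language.{0, 0}) : ℕ → Type
  | pt : ProdRel L 1
  | idx : ProdRel L 1
  | proj : ProdRel L 2
  | same : ProdRel L 2
  | lab : ProdRel L 2
  | base {k : ℕ} (s : BaseSym L k) : ProdRel L k

/-- The vocabulary of labelled products of `L`-structures with sets. -/
def prodLang (L : FirstOrder.Language.{0, 0}) : FirstOrder.Language.{0, 0} :=
  ⟨fun _ => Empty, ProdRel L⟩

instance : (prodLang L).IsRelational := fun _ => inferInstanceAs (IsEmpty Empty)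

instance [Countable L.Symbols] : Countable (Σ k, BaseSym L k) := by
  let f : L.Symbols → Σ k, BaseSym L k :=
    Sum.elim (fun s => ⟨_, .graph s.2⟩) fun s => ⟨_, .rel s.2⟩
  refine Function.Surjective.countable (f := f) ?_
  rintro ⟨k, s⟩
  cases s with
  | rel R => exact ⟨.inr ⟨_, R⟩, rfl⟩
  | graph g => exact ⟨.inl ⟨_, g⟩, rfl⟩

instance [Countable L.Symbols] : Countable (prodLang L).Symbols := by
  let f : Fin 5 ⊕ (Σ k, BaseSym L k) → (prodLang L).Symbols := fun s => .inr <| s.elim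
    ![⟨1, .pt⟩, ⟨1, .idx⟩, ⟨2, .proj⟩, ⟨2, .same⟩, ⟨2, .lab⟩] fun s => ⟨s.1, .base s.2⟩
  refine Function.Surjective.countable (f := f) ?_
  rintro (⟨k, s⟩ | ⟨k, s⟩)
  · exact isEmptyElim (α := Empty) s
  · cases s with
    | pt => exact ⟨.inl 0, rfl⟩
    | idx => exact ⟨.inl 1, rfl⟩
    | proj => exact ⟨.inl 2, rfl⟩
    | same => exact ⟨.inl 3, rfl⟩
    | lab => exact ⟨.inl 4, rfl⟩
    | base s => exact ⟨.inr ⟨_, s⟩, rfl⟩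

/-- The relation on an `L`-structure denoted by a symbol. -/
def BaseSym.Holds {N : Type u} [L.Structure N] : {k : ℕ} → BaseSym L k → (Fin k → N) → Prop
  | _, .rel R, x => Structure.RelMap R x
  | _, .graph f, x => Structure.funMap f (Fin.init x) = x (Fin.last _)

lemma BaseSym.holds_comp {N N' : Type u} [L.Structure N] [L.Structure N'] (g : N ↪[L] N') {k : ℕ}
    (s : BaseSym L k) (x : Fin k → N) : s.Holds (g ∘ x) ↔ s.Holds x := by
  cases s with
  | rel R => exact StrongHomClass.map_rel g R x
  | graph f =>
    change Structure.funMap f (g ∘ Fin.init x) = g (x (Fin.last _)) ↔ _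
    rw [← HomClass.map_fun, g.injective.eq_iff]
    rfl

/-- A map preserving all basic relations in both directions is an embedding. -/
def embeddingOfHolds {N N' : Type u} [L.Structure N] [L.Structure N'] (g : N → N')
    (hg : Function.Injective g)
    (h : ∀ {k : ℕ} (s : BaseSym L k) (x : Fin k → N), s.Holds (g ∘ x) ↔ s.Holds x) : N ↪[L] N' where
  toFun := g
  inj' := hg
  map_fun' {k} f x := by
    have := (h (.graph f) (Fin.snoc x (Structure.funMap f x))).2 (by simp [BaseSym.Holds])
    rw [Fin.comp_snoc] at this
    simpa [BaseSym.Holds] using this.symm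
  map_rel' R x := h (.rel R) x

/-- The labelled product of `N` and `B` with labelling `F`, disjoint from a copy of `B`. -/
def LabProd {N B : Type u} (_F : N → B → Prop) : Type u := (N × B) ⊕ B

namespace LabProd

variable {N B : Type u} [L.Structure N] {F : N → B → Prop}

def point (F : N → B → Prop) (n : N) (b : B) : LabProd F := Sum.inl (n, b)

def index (F : N → B → Prop) (b : B) : LabProd F := Sum.inr b

@[elab_as_elim]
lemma cases {p : LabProd F → Prop} (point : ∀ n b, p (point F n b)) (index : ∀ b, p (index F b))
    (x : LabProd F) : p x := by
  rcases x with ⟨n, b⟩ | b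
  exacts [point n b, index b]

@[simp] lemma point_inj {n n' : N} {b b' : B} : point F n b = point F n' b' ↔ n = n' ∧ b = b' :=
  Sum.inl_injective.eq_iff.trans Prod.mk_inj

@[simp] lemma index_inj {b b' : B} : index F b = index F b' ↔ b = b' :=
  Sum.inr_injective.eq_iff

@[simp] lemma point_ne_index {n : N} {b b' : B} : point F n b ≠ index F b' :=
  Sum.inl_ne_inr

@[simp] lemma index_ne_point {n : N} {b b' : B} : index F b' ≠ point F n b :=
  Sum.inr_ne_inl

/-- The interpretation of the product vocabulary in a labelled product. -/
def Rel (F : N → B → Prop) : {k : ℕ} → ProdRel L k → (Fin k → LabProd F) → Prop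
  | _, .pt, x => ∃ n b, x 0 = point F n b
  | _, .idx, x => ∃ b, x 0 = index F b
  | _, .proj, x => ∃ n b, x 0 = point F n b ∧ x 1 = index F b
  | _, .same, x => ∃ n b b', x 0 = point F n b ∧ x 1 = point F n b'
  | _, .lab, x => ∃ n b b', x 0 = point F n b ∧ x 1 = index F b' ∧ F n b'
  | k, .base s, x => ∃ (n : Fin k → N) (b : Fin k → B), x = (fun i => point F (n i) (b i)) ∧ s.Holds n

instance : (prodLang L).Structure (LabProd F) where
  funMap f := isEmptyElim (α := Empty) f
  RelMap R x := Rel F R x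

end LabProd

section Abbrev

variable (L) {X : Type u} [(prodLang L).Structure X]

/-- The symbol for the sort of points. -/
def ptSym : (prodLang L).Relations 1 := ProdRel.pt

/-- The symbol for the sort of indices. -/
def idxSym : (prodLang L).Relations 1 := ProdRel.idx

/-- The symbol for the projection of points to indices. -/
def projSym : (prodLang L).Relations 2 := ProdRel.proj

def Pt (x : X) : Prop := Structure.RelMap (ptSym L) ![x]

def Idx (x : X) : Prop := Structure.RelMap (idxSym L) ![x]

def Proj (x y : X) : Prop := Structure.RelMap (projSym L) ![x, y]

def Same (x y : X) : Prop := Structure.RelMap (L := prodLang L) ProdRel.same ![x, y]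

def Lab (x y : X) : Prop := Structure.RelMap (L := prodLang L) ProdRel.lab ![x, y]

def Base {k : ℕ} (s : BaseSym L k) (x : Fin k → X) : Prop :=
  Structure.RelMap (L := prodLang L) (ProdRel.base s) x

variable {n : ℕ} (v : Fin n → X) (i j : Fin n)

def fPt : Formula (prodLang L) n := .atom (ptSym L) ![i]

def fIdx : Formula (prodLang L) n := .atom (idxSym L) ![i]

def fProj : Formula (prodLang L) n := .atom (projSym L) ![i, j]

def fSame : Formula (prodLang L) n := .atom (L := prodLang L) ProdRel.same ![i, j]

def fLab : Formula (prodLang L) n := .atom (L := prodLang L) ProdRel.lab ![i, j]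

variable {L} in
def fBase {k : ℕ} (s : BaseSym L k) (g : Fin k → Fin n) : Formula (prodLang L) n :=
  .atom (L := prodLang L) (ProdRel.base s) g

@[simp] lemma realize_fPt : (fPt L i).Realize X v ↔ Pt L (v i) := Formula.realize_atom_one _ _ _

@[simp] lemma realize_fIdx : (fIdx L i).Realize X v ↔ Idx L (v i) := Formula.realize_atom_one _ _ _

@[simp] lemma realize_fProj : (fProj L i j).Realize X v ↔ Proj L (v i) (v j) :=
  Formula.realize_atom_two _ _ _ _

@[simp] lemma realize_fSame : (fSame L i j).Realize X v ↔ Same L (v i) (v j) :=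
  Formula.realize_atom_two _ _ _ _

@[simp] lemma realize_fLab : (fLab L i j).Realize X v ↔ Lab L (v i) (v j) :=
  Formula.realize_atom_two _ _ _ _

@[simp] lemma realize_fBase {k : ℕ} (s : BaseSym L k) (g : Fin k → Fin n) :
    (fBase s g).Realize X v ↔ Base L s fun i => v (g i) := Iff.rfl

end Abbrev

namespace LabProd

variable {N B : Type u} [L.Structure N] {F : N → B → Prop}

@[simp] lemma pt_point (n : N) (b : B) : Pt L (point F n b) := ⟨n, b, rfl⟩
@[simp] lemma not_pt_index (b : B) : ¬ Pt L (index F b) := fun ⟨_, _, h⟩ => index_ne_point h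
@[simp] lemma idx_index (b : B) : Idx L (index F b) := ⟨b, rfl⟩
@[simp] lemma not_idx_point (n : N) (b : B) : ¬ Idx L (point F n b) :=
  fun ⟨_, h⟩ => point_ne_index h

lemma pt_iff {x : LabProd F} : Pt L x ↔ ∃ n b, x = point F n b := Iff.rfl

lemma idx_iff {x : LabProd F} : Idx L x ↔ ∃ b, x = index F b := Iff.rfl

lemma proj_iff {x y : LabProd F} : Proj L x y ↔ ∃ n b, x = point F n b ∧ y = index F b := Iff.rfl

lemma same_iff {x y : LabProd F} :
    Same L x y ↔ ∃ n b b', x = point F n b ∧ y = point F n b' := Iff.rfl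

lemma lab_iff {x y : LabProd F} :
    Lab L x y ↔ ∃ n b b', x = point F n b ∧ y = index F b' ∧ F n b' := Iff.rfl

lemma base_iff {k : ℕ} {s : BaseSym L k} {x : Fin k → LabProd F} :
    Base L s x ↔ ∃ (n : Fin k → N) (b : Fin k → B), x = (fun i => point F (n i) (b i)) ∧ s.Holds n := Iff.rfl

@[simp] lemma proj_point_index {n : N} {b b' : B} :
    Proj L (point F n b) (index F b') ↔ b = b' := by
  simp [proj_iff]

@[simp] lemma same_point_point {n n' : N} {b b' : B} :
    Same L (point F n b) (point F n' b') ↔ n = n' := by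
  simp [same_iff, eq_comm]

@[simp] lemma lab_point_index {n : N} {b b' : B} :
    Lab L (point F n b) (index F b') ↔ F n b' := by
  simp [lab_iff]

@[simp] lemma base_point {k : ℕ} {s : BaseSym L k} {n : Fin k → N} {b : Fin k → B} :
    Base L s (fun i => point F (n i) (b i)) ↔ s.Holds n := by
  simp only [base_iff, funext_iff, point_inj]
  constructor
  · rintro ⟨n', b', h, h'⟩
    rwa [show n = n' from funext fun i => (h i).1]
  · exact fun h => ⟨n, b, fun i => ⟨rfl, rfl⟩, h⟩

end LabProd

/-- A bijection preserving the relations of the product vocabulary, as an isomorphism. -/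
def prodEquiv {X Y : Type u} [(prodLang L).Structure X] [(prodLang L).Structure Y] (e : X ≃ Y)
    (hpt : ∀ x, Pt L (e x) ↔ Pt L x) (hidx : ∀ x, Idx L (e x) ↔ Idx L x)
    (hproj : ∀ x y, Proj L (e x) (e y) ↔ Proj L x y)
    (hsame : ∀ x y, Same L (e x) (e y) ↔ Same L x y)
    (hlab : ∀ x y, Lab L (e x) (e y) ↔ Lab L x y)
    (hbase : ∀ {k : ℕ} (s : BaseSym L k) (x : Fin k → X), Base L s (e ∘ x) ↔ Base L s x) :
    X ≃[prodLang L] Y where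
  toEquiv := e
  map_fun' f := isEmptyElim f
  map_rel' R x := by
    have h₁ : ∀ {Z : Type u} (x : Fin 1 → Z), ![x 0] = x := fun x => by
      ext i
      fin_cases i
      rfl
    have h₂ : ∀ {Z : Type u} (x : Fin 2 → Z), ![x 0, x 1] = x := fun x => by
      ext i
      fin_cases i <;> rfl
    cases R with
    | base s => exact hbase s x
    | pt =>
      have h := hpt (x 0)
      rw [Pt, Pt, show ![e (x 0)] = e ∘ x from h₁ (e ∘ x), show ![x 0] = x from h₁ x] at h
      exact h
    | idx =>
      have h := hidx (x 0)
      rw [Idx, Idx, show ![e (x 0)] = e ∘ x from h₁ (e ∘ x), show ![x 0] = x from h₁ x] at h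
      exact h
    | proj =>
      have h := hproj (x 0) (x 1)
      rw [Proj, Proj, show ![e (x 0), e (x 1)] = e ∘ x from h₂ (e ∘ x),
        show ![x 0, x 1] = x from h₂ x] at h
      exact h
    | same =>
      have h := hsame (x 0) (x 1)
      rw [Same, Same, show ![e (x 0), e (x 1)] = e ∘ x from h₂ (e ∘ x),
        show ![x 0, x 1] = x from h₂ x] at h
      exact h
    | lab =>
      have h := hlab (x 0) (x 1)
      rw [Lab, Lab, show ![e (x 0), e (x 1)] = e ∘ x from h₂ (e ∘ x),
        show ![x 0, x 1] = x from h₂ x] at h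
      exact h

namespace LabProd

/-- Every tuple of points is given by its tuples of coordinates. -/
lemma exists_of_pt {N B : Type u} [L.Structure N] {F : N → B → Prop} {k : ℕ}
    {x : Fin k → LabProd F} (h : ∀ i, Pt L (x i)) :
    ∃ (n : Fin k → N) (b : Fin k → B), x = fun i => point F (n i) (b i) := by
  choose n b h using h
  exact ⟨n, b, funext h⟩

lemma base_pt {N B : Type u} [L.Structure N] {F : N → B → Prop} {k : ℕ} {s : BaseSym L k}
    {x : Fin k → LabProd F} (h : Base L s x) (i : Fin k) : Pt L (x i) := by
  obtain ⟨n, b, rfl, -⟩ := base_iff.1 h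
  exact pt_point _ _

variable {N N' B B' : Type u} [L.Structure N] [L.Structure N'] {F : N → B → Prop}
    {F' : N' → B' → Prop}

def congr (F : N → B → Prop) (F' : N' → B' → Prop) (g : N ≃ N') (σ : B ≃ B') :
    LabProd F ≃ LabProd F' := (g.prodCongr σ).sumCongr σ

@[simp] lemma congr_point (g : N ≃ N') (σ : B ≃ B') (n : N) (b : B) :
    congr F F' g σ (point F n b) = point F' (g n) (σ b) := rfl

@[simp] lemma congr_index (g : N ≃ N') (σ : B ≃ B') (b : B) :
    congr F F' g σ (index F b) = index F' (σ b) := rfl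

/-- The isomorphism of labelled products given by isomorphisms of the factors. -/
def equiv (g : N ≃[L] N') (σ : B ≃ B') (h : ∀ n b, F' (g n) (σ b) ↔ F n b) :
    LabProd F ≃[prodLang L] LabProd F' :=
  prodEquiv (congr F F' g.toEquiv σ)
    (fun x => by induction x using cases <;> simp)
    (fun x => by induction x using cases <;> simp)
    (fun x y => by
      induction x using cases <;> induction y using cases <;> simp [proj_iff])
    (fun x y => by
      induction x using cases <;> induction y using cases <;> simp [same_iff, eq_comm])
    (fun x y => by
      induction x using cases <;> induction y using cases <;> simp [lab_iff]
      exact h _ _)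
    (fun {k} s x => by
      by_cases hx : ∀ i, Pt L (x i)
      · obtain ⟨n, b, rfl⟩ := exists_of_pt hx
        rw [base_point, ← s.holds_comp g.toEmbedding]
        exact base_point
      · refine iff_of_false (fun h => hx fun i => ?_) fun h => hx fun i => base_pt h i
        have := base_pt h i
        change Pt L (congr F F' g.toEquiv σ (x i)) at this
        revert this
        induction x i using cases <;> simp)

end LabProd

/-! ### Translating formulas about `N` into formulas about first coordinates. -/

section Translation

open Formula

/-- The formula stating that the value of the `L`-term `t` at the first coordinates of the points
`x (ρ i)` is the first coordinate of the point `x z`. -/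
noncomputable def termGraph {n : ℕ} : (t : L.Term (Fin n)) → {m : ℕ} → (ρ : Fin n → Fin m) →
    (z : Fin m) → Formula (prodLang L) m
  | .var i, _, ρ, z => fSame L (ρ i) z
  | .func (l := k) f ts, m, ρ, z => exs k <|
      .and (iAnd fun i => termGraph (ts i) (Fin.castAdd k ∘ ρ) (Fin.natAdd m i))
        (fBase (.graph f) (Fin.snoc (Fin.natAdd m) (Fin.castAdd k z)))

/-- The translation of `L`-formulas to formulas about the first coordinates of points. -/
noncomputable def translate : {n : ℕ} → Formula L n → Formula (prodLang L) n
  | _, .falsum => .falsum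
  | n, .equal s t => .ex <| .and (fPt L (Fin.last n)) <|
      .and (termGraph s Fin.castSucc (Fin.last n)) (termGraph t Fin.castSucc (Fin.last n))
  | n, .rel (k := k) R ts => exs k <|
      .and (iAnd fun i => termGraph (ts i) (Fin.castAdd k) (Fin.natAdd n i))
        (fBase (.rel R) (Fin.natAdd n))
  | _, .imp φ ψ => .imp (translate φ) (translate ψ)
  | _, .conj φ => .conj fun i => translate (φ i)
  | n, .all φ => .all (.imp (fPt L (Fin.last n)) (translate φ))

section Realize

variable {N B : Type u} [L.Structure N] {F : N → B → Prop}

open LabProd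

lemma snoc_point {n : ℕ} (x : Fin n → N) (b : Fin n → B) (y : N) (c : B) :
    (Fin.snoc (fun i => point F (x i) (b i)) (point F y c) : Fin (n + 1) → LabProd F) =
      fun i => point F ((Fin.snoc x y : Fin (n + 1) → N) i)
        ((Fin.snoc b c : Fin (n + 1) → B) i) := by
  funext i
  refine Fin.lastCases ?_ (fun i => ?_) i <;> simp

lemma append_point {n k : ℕ} (x : Fin n → N) (b : Fin n → B) (y : Fin k → N) (c : Fin k → B) :
    Fin.append (fun i => point F (x i) (b i)) (fun i => point F (y i) (c i)) =
      fun i => point F (Fin.append x y i) (Fin.append b c i) := by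
  funext i
  refine Fin.addCases (fun i => ?_) (fun i => ?_) i <;> simp

/-- Every relation used in the graph formula ignores second coordinates, so induction on the term
may choose those of the intermediate values freely. -/
lemma realize_termGraph {n : ℕ} (t : L.Term (Fin n)) : ∀ {m : ℕ} (ρ : Fin n → Fin m) (z : Fin m)
    (x : Fin m → N) (b : Fin m → B),
    (termGraph t ρ z).Realize (LabProd F) (fun i => point F (x i) (b i)) ↔
      t.realize (fun i => x (ρ i)) = x z := by
  induction t with
  | var i =>
    intro m ρ z x b
    rw [termGraph, realize_fSame]
    exact same_point_point
  | @func k f ts ih =>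
    intro m ρ z x b
    rw [termGraph, realize_exs]
    simp only [Formula.realize_and, realize_iAnd, Term.realize_func]
    have hgraph : ∀ (y : Fin k → N) (c : Fin k → B),
        (fBase (.graph f)
          (Fin.snoc (Fin.natAdd m) (Fin.castAdd k z))).Realize (LabProd F)
          (fun i => point F (Fin.append x y i) (Fin.append b c i)) ↔
        Structure.funMap f y = x z := by
      intro y c
      rw [realize_fBase]
      refine base_point.trans ?_
      have h₁ : Fin.init (fun i => Fin.append x y
          ((Fin.snoc (Fin.natAdd m) (Fin.castAdd k z) : Fin (k + 1) → Fin (m + k)) i)) = y := by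
        funext i
        simp [Fin.init]
      simp only [BaseSym.Holds, h₁, Fin.snoc_last, Fin.append_left]
    constructor
    · rintro ⟨w, h₁, h₂⟩
      -- The quantified witnesses range over both sorts; the base relation forces them to be points.
      have hw : ∀ i, Pt L (w i) := by
        intro i
        have := base_pt h₂ i.castSucc
        simpa using this
      obtain ⟨y, c, rfl⟩ := exists_of_pt hw
      rw [append_point] at h₁ h₂
      rw [hgraph] at h₂
      rw [← h₂]
      congr 1
      funext i
      have := h₁ i
      rw [ih] at this
      simpa using this
    · intro h
      -- Any index would do as second coordinate; `b z` is available without assuming `B` nonempty.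
      refine ⟨fun i => point F ((ts i).realize fun i => x (ρ i)) (b z), ?_⟩
      rw [append_point, hgraph]
      refine ⟨fun i => ?_, h⟩
      simp [ih]

/-- Since `B` is nonempty, each element of `N` is the first coordinate of some point, so quantifying
over points amounts to quantifying over `N`. -/
lemma realize_translate [Nonempty B] {n : ℕ} (φ : Formula L n) : ∀ (x : Fin n → N) (b : Fin n → B),
    (translate φ).Realize (LabProd F) (fun i => point F (x i) (b i)) ↔ φ.Realize N x := by
  induction φ with
  | falsum => exact fun x b => Iff.rfl
  | imp φ ψ h₁ h₂ =>
    intro x b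
    rw [translate, Formula.realize_imp, h₁, h₂, Formula.realize_imp]
  | conj φ h =>
    intro x b
    rw [translate, realize_conj, realize_conj]
    exact forall_congr' fun i => h i x b
  | all φ h =>
    intro x b
    rw [translate, Formula.realize_all, Formula.realize_all]
    constructor
    · intro hx y
      rw [← h _ (Fin.snoc b (Classical.arbitrary B)), ← snoc_point]
      exact hx _ (by simp)
    · intro hx y
      rw [Formula.realize_imp, realize_fPt, Fin.snoc_last]
      rintro ⟨y, c, rfl⟩
      rw [snoc_point, h]
      exact hx y
  | equal s t =>
    intro x b
    rw [translate, realize_ex]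
    simp only [Formula.realize_and, realize_fPt, Fin.snoc_last]
    constructor
    · rintro ⟨_, ⟨y, c, rfl⟩, hs, ht⟩
      rw [snoc_point, realize_termGraph] at hs ht
      simp only [Fin.snoc_castSucc, Fin.snoc_last] at hs ht
      exact hs.trans ht.symm
    · intro h
      refine ⟨point F (s.realize x) (Classical.arbitrary B), pt_point _ _, ?_⟩
      rw [snoc_point, realize_termGraph, realize_termGraph]
      simpa using Eq.symm h
  | @rel n k R ts =>
    intro x b
    rw [translate, realize_exs]
    simp only [Formula.realize_and, realize_iAnd, realize_fBase, Fin.append_right]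
    constructor
    · rintro ⟨w, h₁, h₂⟩
      obtain ⟨y, c, hw⟩ := exists_of_pt (base_pt h₂)
      obtain rfl : w = _ := hw
      rw [append_point] at h₁
      rw [base_point] at h₂
      simp only [realize_termGraph, Fin.append_left, Fin.append_right] at h₁
      have h₂ : Structure.RelMap R y := h₂
      simpa only [Formula.Realize, h₁] using h₂
    · intro h
      refine ⟨fun i => point F ((ts i).realize x) (Classical.arbitrary B), ?_, base_point.2 h⟩
      rw [append_point]
      simp [realize_termGraph]

end Realize

end Translation

/-! ### Axioms for labelled products. -/

section Axiomatizable

/-- A property of structures expressed by a sentence of `L_{ω₁,ω}`. -/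
def Axiomatizable {L : FirstOrder.Language.{0, 0}}
    (Q : ∀ (X : Type u) [L.Structure X], Prop) : Prop :=
  ∃ σ : Sentence L, ∀ (X : Type u) [L.Structure X], σ.Realize X Fin.elim0 ↔ Q X

variable {L : FirstOrder.Language.{0, 0}} {Q Q' : ∀ (X : Type u) [L.Structure X], Prop}

lemma Axiomatizable.and (h : Axiomatizable Q) (h' : Axiomatizable Q') :
    Axiomatizable (L := L) fun X _ => Q X ∧ Q' X := by
  obtain ⟨σ, h⟩ := h
  obtain ⟨σ', h'⟩ := h'
  exact ⟨.and σ σ', fun X _ => by rw [Formula.realize_and, h, h']⟩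

lemma Axiomatizable.forall {ι : Type*} [Countable ι]
    {Q : ι → ∀ (X : Type u) [L.Structure X], Prop} (h : ∀ i, Axiomatizable (Q i)) :
    Axiomatizable (L := L) fun X _ => ∀ i, Q i X := by
  choose σ h using h
  exact ⟨.iAnd σ, fun X _ => by simp only [Formula.realize_iAnd, h]⟩

lemma Axiomatizable.of_alls {n : ℕ} (φ : Formula L n)
    (h : ∀ (X : Type u) [L.Structure X], (∀ v : Fin n → X, φ.Realize X v) ↔ Q X) :
    Axiomatizable Q :=
  ⟨.alls φ, fun X _ => by rw [Formula.realize_alls, h]⟩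

end Axiomatizable

/-- This form says that no finite tuple exhausts the set, which a countable conjunction can express.
-/
lemma infinite_iff_forall_exists_ne {X : Type u} (S : Set X) :
    S.Infinite ↔ ∀ (k : ℕ) (w : Fin k → X), ∃ x ∈ S, ∀ i, x ≠ w i := by
  constructor
  · intro h k w
    obtain ⟨x, hx, hw⟩ := h.exists_notMem_finite (Set.finite_range w)
    exact ⟨x, hx, fun i hi => hw ⟨i, hi.symm⟩⟩
  · intro h hS
    obtain ⟨k, f, -, rfl⟩ := hS.fin_param
    obtain ⟨_, ⟨i, rfl⟩, hx⟩ := h k f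
    exact hx i rfl

variable {L : FirstOrder.Language.{0, 0}}

/-- The basic axioms of labelled products. -/
structure IsProductLike (P : L.Relations 1) (X : Type u) [(prodLang L).Structure X] : Prop where
  pt_iff : ∀ x : X, Pt L x ↔ ¬ Idx L x
  proj_mem : ∀ x b : X, Proj L x b → Pt L x ∧ Idx L b
  proj_ex : ∀ x : X, Pt L x → ∃ b, Proj L x b
  proj_uniq : ∀ x b c : X, Proj L x b → Proj L x c → b = c
  same_mem : ∀ x y : X, Same L x y → Pt L x ∧ Pt L y
  same_refl : ∀ x : X, Pt L x → Same L x x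
  same_euclid : ∀ x y z : X, Same L x y → Same L x z → Same L y z
  prod_ex : ∀ x b : X, Pt L x → Idx L b → ∃ y, Same L x y ∧ Proj L y b
  prod_uniq : ∀ x y b : X, Same L x y → Proj L x b → Proj L y b → x = y
  base_mem : ∀ (s : Σ k, BaseSym L k) (x : Fin s.1 → X), Base L s.2 x → ∀ i, Pt L (x i)
  base_congr : ∀ (s : Σ k, BaseSym L k) (x y : Fin s.1 → X), (∀ i, Same L (x i) (y i)) →
    Base L s.2 x → Base L s.2 y
  graph_ex : ∀ (f : Σ k, L.Functions k) (x : Fin f.1 → X), (∀ i, Pt L (x i)) →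
    ∃ z, Base L (.graph f.2) (Fin.snoc x z : Fin (f.1 + 1) → X)
  graph_uniq : ∀ (f : Σ k, L.Functions k) (x : Fin f.1 → X) (y z : X),
    Base L (.graph f.2) (Fin.snoc x y : Fin (f.1 + 1) → X) →
    Base L (.graph f.2) (Fin.snoc x z : Fin (f.1 + 1) → X) → Same L y z
  lab_mem : ∀ x b : X, Lab L x b → Idx L b ∧ Base L (.rel P) ![x]
  lab_congr : ∀ x y b : X, Same L x y → Lab L x b → Lab L y b
  lab_ex : ∀ x : X, Base L (.rel P) ![x] → ∃ b, Lab L x b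
  lab_uniq : ∀ x b c : X, Lab L x b → Lab L x c → b = c
  lab_inf : ∀ b : X, Idx L b → {x | Lab L x b ∧ Proj L x b}.Infinite
  idx_inf : {x : X | Idx L x}.Infinite

section Axioms

open Formula

variable (L) in
lemma axiomatizable_sorts : Axiomatizable.{u} fun X [(prodLang L).Structure X] =>
    (∀ x : X, Pt L x ↔ ¬ Idx L x) ∧ (∀ x b : X, Proj L x b → Pt L x ∧ Idx L b) ∧
    (∀ x : X, Pt L x → ∃ b, Proj L x b) ∧ (∀ x b c : X, Proj L x b → Proj L x c → b = c) := by
  refine .and (.of_alls (n := 1) (.and (.imp (fPt L 0) (.neg (fIdx L 0)))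
    (.imp (.neg (fIdx L 0)) (fPt L 0))) fun X _ => ?_) <| .and
    (.of_alls (n := 2) (.imp (fProj L 0 1) (.and (fPt L 0) (fIdx L 1))) fun X _ => ?_) <| .and
    (.of_alls (n := 1) (.imp (fPt L 0) (.ex (fProj L 0 1))) fun X _ => ?_)
    (.of_alls (n := 3) (.imp (fProj L 0 1) (.imp (fProj L 0 2) (.eqv 1 2))) fun X _ => ?_)
  · simp [Fin.forall_fin_succ_pi, iff_def]
  · simp [Fin.forall_fin_succ_pi]
  · simp [Fin.forall_fin_succ_pi, Fin.snoc]
  · simp [Fin.forall_fin_succ_pi]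
    rfl

variable (L) in
lemma axiomatizable_same : Axiomatizable.{u} fun X [(prodLang L).Structure X] =>
    (∀ x y : X, Same L x y → Pt L x ∧ Pt L y) ∧ (∀ x : X, Pt L x → Same L x x) ∧
    (∀ x y z : X, Same L x y → Same L x z → Same L y z) ∧
    (∀ x b : X, Pt L x → Idx L b → ∃ y, Same L x y ∧ Proj L y b) ∧
    (∀ x y b : X, Same L x y → Proj L x b → Proj L y b → x = y) := by
  refine .and (.of_alls (n := 2) (.imp (fSame L 0 1) (.and (fPt L 0) (fPt L 1))) fun X _ => ?_) <|
    .and (.of_alls (n := 1) (.imp (fPt L 0) (fSame L 0 0)) fun X _ => ?_) <| .and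
    (.of_alls (n := 3) (.imp (fSame L 0 1) (.imp (fSame L 0 2) (fSame L 1 2))) fun X _ => ?_) <|
    .and (.of_alls (n := 2) (.imp (fPt L 0) (.imp (fIdx L 1)
      (.ex (.and (fSame L 0 2) (fProj L 2 1))))) fun X _ => ?_)
    (.of_alls (n := 3) (.imp (fSame L 0 1) (.imp (fProj L 0 2) (.imp (fProj L 1 2) (.eqv 0 1))))
      fun X _ => ?_)
  · simp [Fin.forall_fin_succ_pi]
  · simp [Fin.forall_fin_succ_pi]
  · simp [Fin.forall_fin_succ_pi]
    rfl
  · simp [Fin.forall_fin_succ_pi, Fin.snoc]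
  · simp [Fin.forall_fin_succ_pi]
    rfl

lemma axiomatizable_base (k : ℕ) (s : BaseSym L k) :
    Axiomatizable.{u} fun X [(prodLang L).Structure X] =>
    (∀ x : Fin k → X, Base L s x → ∀ i, Pt L (x i)) ∧
    (∀ x y : Fin k → X, (∀ i, Same L (x i) (y i)) → Base L s x → Base L s y) := by
  refine .and (.of_alls (n := k) (.imp (fBase s id) (iAnd fun i => fPt L i)) fun X _ => ?_)
    (.of_alls (n := k + k) (.imp (iAnd fun i => fSame L (Fin.castAdd k i) (Fin.natAdd k i))
      (.imp (fBase s (Fin.castAdd k)) (fBase s (Fin.natAdd k)))) fun X _ => ?_)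
  · simp
  · simp only [Formula.realize_imp, realize_iAnd, realize_fSame, realize_fBase]
    constructor
    · intro h x y
      simpa only [Fin.append_left, Fin.append_right] using h (Fin.append x y)
    · intro h v
      exact h _ _

lemma axiomatizable_graph (k : ℕ) (f : L.Functions k) :
    Axiomatizable.{u} fun X [(prodLang L).Structure X] =>
    (∀ x : Fin k → X, (∀ i, Pt L (x i)) →
      ∃ z, Base L (.graph f) (Fin.snoc x z : Fin (k + 1) → X)) ∧
    (∀ (x : Fin k → X) (y z : X), Base L (.graph f) (Fin.snoc x y : Fin (k + 1) → X) →
      Base L (.graph f) (Fin.snoc x z : Fin (k + 1) → X) → Same L y z) := by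
  refine .and (.of_alls (n := k) (.imp (iAnd fun i => fPt L i) (.ex (fBase (.graph f) id)))
    fun X _ => ?_) (.of_alls (n := k) (.all <| .all <|
      .imp (fBase (.graph f) (Fin.snoc (fun i => i.castSucc.castSucc) (Fin.last k).castSucc)) <|
      .imp (fBase (.graph f) (Fin.snoc (fun i => i.castSucc.castSucc) (Fin.last (k + 1))))
      (fSame L (Fin.last k).castSucc (Fin.last (k + 1)))) fun X _ => ?_)
  · simp
  · have h : ∀ (x : Fin k → X) (y z : X) (j : Fin (k + 2)),
        (fun i => (Fin.snoc (Fin.snoc x y : Fin (k + 1) → X) z : Fin (k + 2) → X)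
          ((Fin.snoc (fun i => i.castSucc.castSucc) j : Fin (k + 1) → Fin (k + 2)) i)) =
        Fin.snoc x ((Fin.snoc (Fin.snoc x y : Fin (k + 1) → X) z : Fin (k + 2) → X) j) := by
      intro x y z j
      funext i
      refine Fin.lastCases ?_ (fun i => ?_) i <;> simp
    simp [h]

lemma axiomatizable_lab (P : L.Relations 1) :
    Axiomatizable.{u} fun X [(prodLang L).Structure X] =>
    (∀ x b : X, Lab L x b → Idx L b ∧ Base L (.rel P) ![x]) ∧
    (∀ x y b : X, Same L x y → Lab L x b → Lab L y b) ∧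
    (∀ x : X, Base L (.rel P) ![x] → ∃ b, Lab L x b) ∧
    (∀ x b c : X, Lab L x b → Lab L x c → b = c) := by
  have hP : ∀ {n : ℕ} {X : Type u} [(prodLang L).Structure X] (i : Fin n) (v : Fin n → X),
      (fBase (.rel P) ![i]).Realize X v ↔ Base L (.rel P) ![v i] := fun i v =>
    realize_atom_one _ _ _
  refine .and (.of_alls (n := 2) (.imp (fLab L 0 1) (.and (fIdx L 1) (fBase (.rel P) ![0])))
    fun X _ => ?_) <| .and
    (.of_alls (n := 3) (.imp (fSame L 0 1) (.imp (fLab L 0 2) (fLab L 1 2))) fun X _ => ?_) <|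
    .and (.of_alls (n := 1) (.imp (fBase (.rel P) ![0]) (.ex (fLab L 0 1))) fun X _ => ?_)
    (.of_alls (n := 3) (.imp (fLab L 0 1) (.imp (fLab L 0 2) (.eqv 1 2))) fun X _ => ?_)
  · simp [Fin.forall_fin_succ_pi, hP, -realize_fBase]
  · simp [Fin.forall_fin_succ_pi]
    rfl
  · simp [Fin.forall_fin_succ_pi, hP, Fin.snoc, -realize_fBase]
  · simp [Fin.forall_fin_succ_pi]
    rfl

variable (L) in
lemma axiomatizable_infinite : Axiomatizable.{u} fun X [(prodLang L).Structure X] =>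
    (∀ b : X, Idx L b → {x | Lab L x b ∧ Proj L x b}.Infinite) ∧
    {x : X | Idx L x}.Infinite := by
  simp only [infinite_iff_forall_exists_ne]
  refine .and ?_ (.forall fun k => ?_)
  -- The index `b` is put in the last place of the tuple to be avoided. Requiring `x ≠ b` as well
  -- costs nothing, since an infinite set avoids any finite tuple.
  · have : Axiomatizable.{u} fun X [(prodLang L).Structure X] => ∀ (k : ℕ),
        ∀ w : Fin (k + 1) → X, Idx L (w (Fin.last k)) →
          ∃ x, Lab L x (w (Fin.last k)) ∧ Proj L x (w (Fin.last k)) ∧ ∀ i, x ≠ w i := by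
      refine .forall fun k => .of_alls (n := k + 1) (.imp (fIdx L (Fin.last k)) (.ex <|
        .and (fLab L (Fin.last _) (Fin.last k).castSucc) <|
        .and (fProj L (Fin.last _) (Fin.last k).castSucc)
        (iAnd fun i : Fin (k + 1) => .neg (.eqv (Fin.last _) i.castSucc)))) fun X _ => ?_
      simp
    obtain ⟨σ, hσ⟩ := this
    refine ⟨σ, fun X _ => (hσ X).trans ⟨fun h b hb k w => ?_, fun h k w hb => ?_⟩⟩
    · obtain ⟨x, h₁, h₂, h₃⟩ := h k (Fin.snoc w b) (by simpa using hb)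
      rw [Fin.snoc_last] at h₁ h₂
      exact ⟨x, ⟨h₁, h₂⟩, fun i => by simpa using h₃ i.castSucc⟩
    · obtain ⟨x, ⟨h₁, h₂⟩, h₃⟩ := h _ hb _ w
      exact ⟨x, h₁, h₂, h₃⟩
  · refine .of_alls (n := k) (.ex (.and (fIdx L (Fin.last k))
      (iAnd fun i : Fin k => .neg (.eqv (Fin.last _) i.castSucc)))) fun X _ => ?_
    simp

theorem axiomatizable_isProductLike [Countable L.Symbols] (P : L.Relations 1) :
    Axiomatizable.{u} fun X [(prodLang L).Structure X] => IsProductLike P X := by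
  have : Countable (Σ k, L.Functions k) :=
    Function.Injective.countable (β := L.Symbols) (f := Sum.inl) Sum.inl_injective
  obtain ⟨σ, hσ⟩ := (axiomatizable_sorts L).and <| (axiomatizable_same L).and <|
    (Axiomatizable.forall fun s : Σ k, BaseSym L k => axiomatizable_base s.1 s.2).and <|
    (Axiomatizable.forall fun f : Σ k, L.Functions k => axiomatizable_graph f.1 f.2).and <|
    (axiomatizable_lab P).and (axiomatizable_infinite L)
  refine ⟨σ, fun X _ => (hσ X).trans ⟨?_, fun h => ?_⟩⟩
  · rintro ⟨⟨h₁, h₂, h₃, h₄⟩, ⟨h₅, h₆, h₇, h₈, h₉⟩, hb, hg, ⟨l₁, l₂, l₃, l₄⟩, i₁, i₂⟩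
    exact ⟨h₁, h₂, h₃, h₄, h₅, h₆, h₇, h₈, h₉, fun s => (hb s).1, fun s => (hb s).2,
      fun f => (hg f).1, fun f => (hg f).2, l₁, l₂, l₃, l₄, i₁, i₂⟩
  · exact ⟨⟨h.pt_iff, h.proj_mem, h.proj_ex, h.proj_uniq⟩, ⟨h.same_mem, h.same_refl, h.same_euclid,
      h.prod_ex, h.prod_uniq⟩, fun s => ⟨h.base_mem s, h.base_congr s⟩,
      fun f => ⟨h.graph_ex f, h.graph_uniq f⟩, ⟨h.lab_mem, h.lab_congr, h.lab_ex, h.lab_uniq⟩,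
      h.lab_inf, h.idx_inf⟩

end Axioms

/-! ### Labellings versus the product axioms. -/

/-- `F` is the graph of a function from the set defined by `P` to `B` with infinite fibres. -/
structure IsLabelling {N B : Type u} [L.Structure N] (P : L.Relations 1) (F : N → B → Prop) :
    Prop where
  mem : ∀ n b, F n b → n ∈ predSet P N
  ex : ∀ n ∈ predSet P N, ∃ b, F n b
  uniq : ∀ n b c, F n b → F n c → b = c
  inf : ∀ b, {n | F n b}.Infinite

namespace LabProd

variable {N B : Type u} [L.Structure N] {F : N → B → Prop} {P : L.Relations 1}

lemma base_rel_point {n : N} {b : B} : Base L (.rel P) ![point F n b] ↔ n ∈ predSet P N := by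
  have : ![point F n b] = fun i : Fin 1 => point F (![n] i) (![b] i) := by
    funext i
    fin_cases i
    rfl
  rw [this, base_point]
  rfl

lemma isLabelling [Nonempty B] (h : IsProductLike P (LabProd F)) : IsLabelling P F where
  mem n b hF := base_rel_point.1 (h.lab_mem _ _ (lab_point_index (L := L) (b := b).2 hF)).2
  ex n hn := by
    obtain ⟨c, hc⟩ := h.lab_ex (point F n (Classical.arbitrary B)) (base_rel_point.2 hn)
    obtain ⟨m, b, b', h₁, h₂, h₃⟩ := lab_iff.1 hc
    exact ⟨b', (point_inj.1 h₁).1 ▸ h₃⟩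
  uniq n b c hb hc := by
    simpa using h.lab_uniq (point F n b) (index F b) (index F c) (by simpa) (by simpa)
  inf b := by
    -- The axiom counts only points lying over `b`, that is, one for each first coordinate. Counting
    -- all points labelled `b` would be useless, as one first coordinate already gives infinitely
    -- many points.
    have := h.lab_inf (index F b) (by simp)
    refine fun hfin => this ((hfin.image fun n => point F n b).subset ?_)
    rintro x ⟨hx, hx'⟩
    obtain ⟨n, b, rfl, h₁⟩ := proj_iff.1 hx'
    obtain rfl := index_inj.1 h₁
    exact ⟨n, show F n b from lab_point_index.1 hx, rfl⟩

lemma isProductLike [Infinite B] (h : IsLabelling P F) : IsProductLike P (LabProd F) where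
  pt_iff x := by induction x using cases <;> simp
  proj_mem x b hx := by
    obtain ⟨n, b, rfl, rfl⟩ := proj_iff.1 hx
    simp
  proj_ex x hx := by
    obtain ⟨n, b, rfl⟩ := pt_iff.1 hx
    exact ⟨index F b, by simp⟩
  proj_uniq x b c hb hc := by
    obtain ⟨n, b, rfl, rfl⟩ := proj_iff.1 hb
    obtain ⟨n', b', h₁, rfl⟩ := proj_iff.1 hc
    simp_all
  same_mem x y hx := by
    obtain ⟨n, b, b', rfl, rfl⟩ := same_iff.1 hx
    simp
  same_refl x hx := by
    obtain ⟨n, b, rfl⟩ := pt_iff.1 hx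
    simp
  same_euclid x y z hy hz := by
    obtain ⟨n, b, b', rfl, rfl⟩ := same_iff.1 hy
    obtain ⟨n', c, c', h₁, rfl⟩ := same_iff.1 hz
    simp_all
  prod_ex x b hx hb := by
    obtain ⟨n, c, rfl⟩ := pt_iff.1 hx
    obtain ⟨b, rfl⟩ := idx_iff.1 hb
    exact ⟨point F n b, by simp⟩
  prod_uniq x y b hxy hx hy := by
    obtain ⟨n, b, b', rfl, rfl⟩ := same_iff.1 hxy
    obtain ⟨_, c, h₁, rfl⟩ := proj_iff.1 hx
    simp_all
  base_mem s x hx := base_pt hx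
  base_congr s x y hxy hx := by
    obtain ⟨n, b, rfl, hn⟩ := base_iff.1 hx
    obtain ⟨m, c, rfl⟩ := exists_of_pt fun i => (show Pt L (y i) by
      obtain ⟨_, _, _, -, h⟩ := same_iff.1 (hxy i)
      exact ⟨_, _, h⟩)
    simp only [same_point_point] at hxy
    rw [base_point]
    rwa [← show n = m from funext hxy]
  graph_ex f x hx := by
    obtain ⟨n, b, rfl⟩ := exists_of_pt hx
    refine ⟨point F (Structure.funMap f.2 n) (Classical.arbitrary B), ?_⟩
    rw [snoc_point, base_point]
    simp [BaseSym.Holds]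
  graph_uniq f x y z hy hz := by
    obtain ⟨n, b, rfl⟩ := exists_of_pt fun i => by simpa using base_pt hy (Fin.castSucc i)
    obtain ⟨m, c, rfl⟩ := pt_iff.1 (show Pt L y by simpa using base_pt hy (Fin.last _))
    obtain ⟨m', c', rfl⟩ := pt_iff.1 (show Pt L z by simpa using base_pt hz (Fin.last _))
    rw [snoc_point, base_point] at hy hz
    simp only [BaseSym.Holds, Fin.init_snoc, Fin.snoc_last] at hy hz
    simp [← hy, ← hz]
  lab_mem x b hx := by
    obtain ⟨n, c, b, rfl, rfl, hF⟩ := lab_iff.1 hx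
    exact ⟨by simp, base_rel_point.2 (h.mem n b hF)⟩
  lab_congr x y b hxy hx := by
    obtain ⟨n, b, b', rfl, rfl⟩ := same_iff.1 hxy
    obtain ⟨n', c, b, h₁, rfl, hF⟩ := lab_iff.1 hx
    simp_all
  lab_ex x hx := by
    obtain ⟨n, b, rfl⟩ := pt_iff.1 (show Pt L x from base_pt hx 0)
    obtain ⟨c, hc⟩ := h.ex n (base_rel_point.1 hx)
    exact ⟨index F c, by simpa⟩
  lab_uniq x b c hb hc := by
    obtain ⟨n, a, b, rfl, rfl, hF⟩ := lab_iff.1 hb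
    obtain ⟨n', a', c, h₁, rfl, hF'⟩ := lab_iff.1 hc
    simp only [point_inj] at h₁
    obtain ⟨rfl, rfl⟩ := h₁
    exact congrArg _ (h.uniq _ _ _ hF hF')
  lab_inf b hb := by
    obtain ⟨b, rfl⟩ := idx_iff.1 hb
    refine ((h.inf b).image (f := fun n => point F n b) fun n _ m _ h => ?_).mono ?_
    · simpa using h
    · rintro _ ⟨n, hn, rfl⟩
      exact ⟨lab_point_index.2 hn, by simp⟩
  idx_inf := (Set.infinite_range_of_injective fun b c h => index_inj.1 h).mono
    (s := Set.range (index F)) (by rintro _ ⟨b, rfl⟩; exact idx_index (L := L) b)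

end LabProd

/-! ### Recovering the factors from the axioms. -/

namespace IsProductLike

variable {P : L.Relations 1} {X : Type u} [(prodLang L).Structure X]

lemma same_symm (h : IsProductLike P X) {x y : X} (hxy : Same L x y) : Same L y x :=
  h.same_euclid _ _ _ hxy (h.same_refl _ (h.same_mem _ _ hxy).1)

lemma same_trans (h : IsProductLike P X) {x y z : X} (hxy : Same L x y) (hyz : Same L y z) :
    Same L x z := h.same_euclid _ _ _ (h.same_symm hxy) hyz

/-- The fibre of the projection over an index, which carries an `L`-structure. -/
def Fibre (_ : IsProductLike P X) (b : X) : Type u := {x : X // Proj L x b}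

variable (h : IsProductLike P X)

lemma pt_fibre {b : X} (x : h.Fibre b) : Pt L x.1 := (h.proj_mem _ _ x.2).1

/-- The axioms give a value only up to equality of first coordinates; moving it along its
`Same`-class yields a representative over `b`. -/
lemma exists_funMap {b : X} (hb : Idx L b) {k : ℕ} (f : L.Functions k) (x : Fin k → h.Fibre b) :
    ∃ z : h.Fibre b, Base L (.graph f) (Fin.snoc (fun i => (x i).1) z.1 : Fin (k + 1) → X) := by
  obtain ⟨z, hz⟩ := h.graph_ex ⟨k, f⟩ (fun i => (x i).1) fun i => h.pt_fibre _
  have hpt : Pt L z := by simpa using h.base_mem ⟨k + 1, .graph f⟩ _ hz (Fin.last k)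
  obtain ⟨y, hzy, hy⟩ := h.prod_ex z b hpt hb
  refine ⟨⟨y, hy⟩, h.base_congr ⟨k + 1, .graph f⟩ _ _ (fun i => ?_) hz⟩
  refine Fin.lastCases ?_ (fun i => ?_) i
  · simpa using hzy
  · simpa using h.same_refl _ (h.pt_fibre (x i))

/-- The `L`-structure on a fibre. -/
noncomputable abbrev fibreStructure {b : X} (hb : Idx L b) : L.Structure (h.Fibre b) where
  funMap f x := (h.exists_funMap hb f x).choose
  RelMap R x := Base L (.rel R) fun i => (x i).1

lemma holds_fibre {b : X} (hb : Idx L b) {k : ℕ} (s : BaseSym L k) (x : Fin k → h.Fibre b) :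
    letI := h.fibreStructure hb
    s.Holds x ↔ Base L s fun i => (x i).1 := by
  let := h.fibreStructure hb
  cases s with
  | rel R => exact Iff.rfl
  | @graph k f =>
    have hf := (h.exists_funMap hb f (Fin.init x)).choose_spec
    have hx : (fun i => (x i).1) =
        (Fin.snoc (fun i => (Fin.init x i).1) (x (Fin.last k)).1 : Fin (k + 1) → X) := by
      conv_lhs => rw [← Fin.snoc_init_self x]
      exact Fin.comp_snoc (Subtype.val : h.Fibre b → X) (Fin.init x) _
    rw [hx]
    constructor
    · intro hfx
      rw [← hfx]
      exact hf
    · intro hfx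
      exact Subtype.ext (h.prod_uniq _ _ b (h.graph_uniq ⟨k, f⟩ _ _ _ hf hfx)
        (h.exists_funMap hb f (Fin.init x)).choose.2 (x (Fin.last k)).2)

/-- Being product-like is expressed by a sentence, hence invariant under isomorphism. -/
lemma of_equiv [Countable L.Symbols] {Y : Type u} [(prodLang L).Structure Y]
    (h : IsProductLike P X) (e : X ≃[prodLang L] Y) : IsProductLike P Y := by
  obtain ⟨σ, hσ⟩ := axiomatizable_isProductLike.{u} P
  refine (hσ Y).1 ?_
  rw [Subsingleton.elim Fin.elim0 (e ∘ Fin.elim0)]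
  exact (Formula.realize_equiv e σ _).2 ((hσ X).2 h)

/-- Product-like structures are isomorphic to labelled products. -/
theorem exists_equiv_labProd [Countable L.Symbols] (h : IsProductLike P X) :
    ∃ (N B : Type u) (_ : L.Structure N) (F : N → B → Prop), Infinite B ∧ IsLabelling P F ∧
      Nonempty (LabProd F ≃[prodLang L] X) := by
  -- The fibre over an arbitrary index `b₀` serves as the first factor, as it contains exactly one
  -- point of each `Same`-class.
  obtain ⟨b₀, hb₀⟩ := h.idx_inf.nonempty
  let N := h.Fibre b₀
  let B := {b : X // Idx L b}
  let := h.fibreStructure hb₀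
  let F : N → B → Prop := fun n b => Lab L n.1 b.1
  have hpt : ∀ n : N, Pt L n.1 := h.pt_fibre
  -- `c n b` is the point that plays the role of the pair `(n, b)`.
  choose c hc₁ hc₂ using fun (n : N) (b : B) => h.prod_ex n.1 b.1 (hpt n) b.2
  have hnot : ∀ {x : X}, Pt L x → Idx L x → False := fun hx hx' => (h.pt_iff _).1 hx hx'
  have hcpt : ∀ n b, Pt L (c n b) := fun n b => (h.same_mem _ _ (hc₁ n b)).2
  have hcsame : ∀ n b n' b', Same L (c n b) (c n' b') ↔ n = n' := by
    intro n b n' b'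
    constructor
    · intro hs
      exact Subtype.ext (h.prod_uniq _ _ b₀
        (h.same_trans (h.same_trans (hc₁ n b) hs) (h.same_symm (hc₁ n' b'))) n.2 n'.2)
    · rintro rfl
      exact h.same_euclid _ _ _ (hc₁ n b) (hc₁ n b')
  let e₀ : LabProd F → X := Sum.elim (fun y => c y.1 y.2) fun b => b.1
  have hp : ∀ n b, e₀ (LabProd.point F n b) = c n b := fun _ _ => rfl
  have hi : ∀ b, e₀ (LabProd.index F b) = b.1 := fun _ => rfl
  have hbij : Function.Bijective e₀ := by
    constructor
    · intro x y
      induction x using LabProd.cases with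
      | point n b =>
        induction y using LabProd.cases with
        | point n' b' =>
          rw [hp, hp]
          intro hcc
          obtain rfl := (hcsame n b n' b').1 (hcc ▸ h.same_refl _ (hcpt n b))
          rw [show b = b' from Subtype.ext (h.proj_uniq _ _ _ (hc₂ n b) (hcc ▸ hc₂ n b'))]
        | index b' =>
          rw [hp, hi]
          exact fun hcc => (hnot (hcpt n b) (hcc ▸ b'.2)).elim
      | index b =>
        induction y using LabProd.cases with
        | point n' b' =>
          rw [hp, hi]
          exact fun hcc => (hnot (hcpt n' b') (hcc ▸ b.2)).elim
        | index b' =>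
          rw [hi, hi]
          exact fun hcc => by rw [Subtype.ext hcc]
    · intro x
      by_cases hx : Idx L x
      · exact ⟨LabProd.index F ⟨x, hx⟩, rfl⟩
      · have hx := (h.pt_iff x).2 hx
        obtain ⟨b, hb⟩ := h.proj_ex x hx
        obtain ⟨n, hxn, hn⟩ := h.prod_ex x b₀ hx hb₀
        obtain ⟨n, rfl⟩ : ∃ n' : N, n'.1 = n := ⟨⟨n, hn⟩, rfl⟩
        refine ⟨LabProd.point F n ⟨b, (h.proj_mem _ _ hb).2⟩, ?_⟩
        rw [hp]
        exact (h.prod_uniq _ _ b (h.same_trans hxn (hc₁ n _)) hb (hc₂ n _)).symm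
  have hB : Infinite B := h.idx_inf.to_subtype
  let e : LabProd F ≃[prodLang L] X := prodEquiv (Equiv.ofBijective e₀ hbij)
    (fun x => by
      induction x using LabProd.cases with
      | point n b => simpa [hp] using hcpt n b
      | index b => simpa [hi] using fun hb => hnot hb b.2)
    (fun x => by
      induction x using LabProd.cases with
      | point n b => simpa [hp] using fun hb => hnot (hcpt n b) hb
      | index b => simpa [hi] using b.2)
    (fun x y => by
      rw [LabProd.proj_iff]
      induction x using LabProd.cases with
      | point n b =>
        induction y using LabProd.cases with
        | point n' b' => simpa [hp] using fun hb => hnot (hcpt n' b') (h.proj_mem _ _ hb).2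
        | index b' =>
          have : Proj L (c n b) b'.1 ↔ b = b' :=
            ⟨fun hb => Subtype.ext (h.proj_uniq _ _ _ (hc₂ n b) hb), fun hb => hb ▸ hc₂ n b⟩
          simpa [hp, hi] using this
      | index b => simpa [hi] using fun hb => hnot (h.proj_mem _ _ hb).1 b.2)
    (fun x y => by
      rw [LabProd.same_iff]
      induction x using LabProd.cases with
      | point n b =>
        induction y using LabProd.cases with
        | point n' b' => simpa [hp, eq_comm] using hcsame n b n' b'
        | index b' => simpa [hp, hi] using fun hb => hnot (h.same_mem _ _ hb).2 b'.2
      | index b => simpa [hi] using fun hb => hnot (h.same_mem _ _ hb).1 b.2)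
    (fun x y => by
      have hlab : ∀ {x y : X}, Lab L x y → Pt L x := fun hxy =>
        h.base_mem ⟨1, .rel P⟩ _ (h.lab_mem _ _ hxy).2 0
      rw [LabProd.lab_iff]
      induction x using LabProd.cases with
      | point n b =>
        induction y using LabProd.cases with
        | point n' b' => simpa [hp] using fun hb => hnot (hcpt n' b') (h.lab_mem _ _ hb).1
        | index b' =>
          have : Lab L (c n b) b'.1 ↔ F n b' :=
            ⟨fun hb => h.lab_congr _ _ _ (h.same_symm (hc₁ n b)) hb,
              fun hb => h.lab_congr _ _ _ (hc₁ n b) hb⟩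
          simpa [hp, hi] using this
      | index b => simpa [hi] using fun hb => hnot (hlab hb) b.2)
    (fun {k} s x => by
      by_cases hx : ∀ i, Pt L (x i)
      · obtain ⟨n, b, rfl⟩ := LabProd.exists_of_pt hx
        rw [LabProd.base_point, h.holds_fibre hb₀]
        exact ⟨fun hs => h.base_congr ⟨k, s⟩ _ _ (fun i => h.same_symm (hc₁ _ _)) hs,
          fun hs => h.base_congr ⟨k, s⟩ _ _ (fun i => hc₁ _ _) hs⟩
      · refine iff_of_false (fun hs => hx fun i => ?_) fun hs => hx fun i => LabProd.base_pt hs i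
        have := h.base_mem ⟨k, s⟩ _ hs i
        simp only [Function.comp_apply] at this
        revert this
        induction x i using LabProd.cases with
        | point n b => simp
        | index b => simpa [hi] using fun hb => hnot hb b.2)
  exact ⟨N, B, inferInstance, F, hB, LabProd.isLabelling (h.of_equiv e.symm), ⟨e⟩⟩

end IsProductLike

lemma relMap_one {M N F : Type u} [L.Structure M] [L.Structure N] [FunLike F M N]
    [StrongHomClass L F M N] (g : F) (R : L.Relations 1) (x : M) :
    Structure.RelMap R ![g x] ↔ Structure.RelMap R ![x] := by
  rw [← StrongHomClass.map_rel g R, show ![g x] = g ∘ ![x] by ext i; fin_cases i; rfl]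

lemma relMap_two {M N F : Type u} [L.Structure M] [L.Structure N] [FunLike F M N]
    [StrongHomClass L F M N] (g : F) (R : L.Relations 2) (x y : M) :
    Structure.RelMap R ![g x, g y] ↔ Structure.RelMap R ![x, y] := by
  rw [← StrongHomClass.map_rel g R, show ![g x, g y] = g ∘ ![x, y] by ext i; fin_cases i <;> rfl]

lemma IsProductLike.isProjection {P : L.Relations 1} {X : Type u} [(prodLang L).Structure X]
    (h : IsProductLike P X) : IsProjection X (ptSym L) (idxSym L) (projSym L) where
  isCompl := by
    rw [show predSet (ptSym L) X = (predSet (idxSym L) X)ᶜ from Set.ext h.pt_iff]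
    exact isCompl_compl.symm
  subset := h.proj_mem
  function x hx := by
    obtain ⟨b, hb⟩ := h.proj_ex x hx
    exact ⟨b, hb, fun c hc => h.proj_uniq x c b hc hb⟩
  onto b hb := by
    obtain ⟨x, -, hx⟩ := (h.lab_inf b hb).nonempty
    exact ⟨x, hx⟩

/-! ### Existence of labellings and lifting of bijections of labels. -/

/-- An infinite predicate can be labelled by any infinite set which is not larger. -/
lemma exists_isLabelling {N B : Type u} [L.Structure N] [Infinite B] (P : L.Relations 1)
    (h : #B ≤ #(predSet P N)) : ∃ F : N → B → Prop, IsLabelling P F := by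
  have hP : ℵ₀ ≤ #(predSet P N) := (aleph0_le_mk B).trans h
  have hinf : Infinite (predSet P N) := infinite_iff.2 hP
  -- Cardinal arithmetic absorbs the factor `B`. The first coordinate of `e` is then a labelling
  -- each of whose fibres is a copy of the set defined by `P`.
  obtain ⟨e⟩ : Nonempty (predSet P N ≃ B × predSet P N) := by
    rw [← Cardinal.eq, mk_prod, lift_id, lift_id, mul_eq_right hP h (mk_ne_zero B)]
  refine ⟨fun n b => ∃ hn : n ∈ predSet P N, (e ⟨n, hn⟩).1 = b, fun n b hn => hn.1,
    fun n hn => ⟨_, hn, rfl⟩, ?_, fun b => ?_⟩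
  · rintro n b c ⟨_, rfl⟩ ⟨_, rfl⟩
    rfl
  · refine (Set.infinite_range_of_injective (f := fun x => (e.symm (b, x)).1) fun x y hxy => ?_).mono
      ?_
    · simpa using e.symm.injective (Subtype.ext hxy)
    · rintro _ ⟨x, rfl⟩
      exact ⟨(e.symm (b, x)).2, by simp⟩

namespace IsLabelling

variable {N B : Type u} [L.Structure N] {P : L.Relations 1} {F : N → B → Prop}

/-- The labelled set is the disjoint union of the fibres of the labelling. -/
noncomputable def sigmaEquiv (h : IsLabelling P F) : (Σ b, {n // F n b}) ≃ predSet P N :=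
  Equiv.ofBijective (fun x => ⟨x.2.1, h.mem _ _ x.2.2⟩) <| by
    constructor
    · rintro ⟨b, n, hb⟩ ⟨c, m, hc⟩ hnm
      obtain rfl : n = m := congrArg Subtype.val hnm
      obtain rfl := h.uniq _ _ _ hb hc
      rfl
    · rintro ⟨n, hn⟩
      obtain ⟨b, hb⟩ := h.ex n hn
      exact ⟨⟨b, n, hb⟩, rfl⟩

/-- Labelled countable models of a complete sentence are isomorphic over any bijection of the labels
if the labelled predicate is absolutely indiscernible. -/
lemma exists_equiv {φ : Sentence L} (hφ : IsComplete.{u} φ) {M C : Type u} [L.Structure M]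
    {G : M → C → Prop} [Countable N] [Countable M] (hN : IsModel N φ) (hM : IsModel M φ)
    (hind : IsAbsolutelyIndiscernible L (predSet P M)) (hF : IsLabelling P F)
    (hG : IsLabelling P G) (σ : B ≃ C) : ∃ g : N ≃[L] M, ∀ n b, G (g n) (σ b) ↔ F n b := by
  obtain ⟨h⟩ := hφ.nonempty_equiv hN hM
  have hmem : ∀ {A : Type u} [L.Structure A] (k : A ≃[L] M) (n : A),
      n ∈ predSet P A ↔ k n ∈ predSet P M := fun k n => (relMap_one k P n).symm
  -- Infinite fibres in countable structures are all countably infinite, so they can be matched one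
  -- label at a time.
  have hτ : ∀ b, Nonempty ({n // F n b} ≃ {m // G m (σ b)}) := by
    intro b
    have : Infinite {n // F n b} := (hF.inf b).to_subtype
    have : Infinite {m // G m (σ b)} := (hG.inf (σ b)).to_subtype
    rw [← Cardinal.eq, mk_eq_aleph0, mk_eq_aleph0]
  let τ := fun b => (hτ b).some
  let E : predSet P N ≃ predSet P M :=
    hF.sigmaEquiv.symm.trans ((Equiv.sigmaCongr σ τ).trans hG.sigmaEquiv)
  have hE : ∀ n b, (hn : F n b) → G (E ⟨n, hF.mem n b hn⟩) (σ b) := by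
    intro n b hn
    have : hF.sigmaEquiv.symm ⟨n, hF.mem n b hn⟩ = ⟨b, n, hn⟩ := by
      rw [Equiv.symm_apply_eq]
      rfl
    simp only [E, Equiv.trans_apply, this]
    exact (τ b ⟨n, hn⟩).2
  let k : predSet P N ≃ predSet P M := h.toEquiv.subtypeEquiv fun n => hmem h n
  -- The permutation corrects `h`: extended to an automorphism `g`, it makes `g ∘ h` agree with `E`
  -- on the set defined by `P`.
  obtain ⟨g, hg⟩ := hind.2 (k.symm.trans E)
  have hgE : ∀ n (hn : n ∈ predSet P N), g (h n) = E ⟨n, hn⟩ := by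
    intro n hn
    have := hg (k ⟨n, hn⟩)
    rw [Equiv.trans_apply, Equiv.symm_apply_apply] at this
    exact this
  have hGF : ∀ n b, F n b → G (g (h n)) (σ b) := by
    intro n b hn
    rw [hgE n (hF.mem n b hn)]
    exact hE n b hn
  -- The converse direction follows from totality of `F` and uniqueness of labels in `G`.
  refine ⟨g.comp h, fun n b => ⟨fun hn => ?_, hGF n b⟩⟩
  obtain ⟨c, hc⟩ := hF.ex n ((hmem (g.comp h) n).2 (hG.mem _ _ hn))
  have := hG.uniq _ _ _ hn (hGF n c hc)
  rwa [σ.injective this]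

end IsLabelling

/-! ### Cardinality and maximality of labelled products. -/

namespace LabProd

variable {N B : Type u} [L.Structure N] {F : N → B → Prop}

/-- The indices of a labelled product. -/
noncomputable def indexEquiv (F : N → B → Prop) : B ≃ predSet (idxSym L) (LabProd F) :=
  Equiv.ofBijective (fun b => ⟨index F b, idx_index (L := L) b⟩)
    ⟨fun _ _ h => index_inj.1 (congrArg Subtype.val h), fun ⟨_, b, h⟩ => ⟨b, Subtype.ext h.symm⟩⟩

lemma mk_eq [Infinite N] [Nonempty B] (h : #B ≤ #N) : #(LabProd F) = #N := by
  have hN := aleph0_le_mk N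
  change #((N × B) ⊕ B) = #N
  simp only [mk_sum, mk_prod, lift_id]
  rw [mul_eq_left hN h (mk_ne_zero B),
    add_eq_left hN h]

/-- Choosing one element from each fibre is injective because labels are unique. -/
lemma mk_le {P : L.Relations 1} (h : IsLabelling P F) : #B ≤ #N := by
  choose n hn using fun b => (h.inf b).nonempty
  exact mk_le_of_injective (f := n) fun b c hbc => h.uniq _ _ _ (hn b) (hbc ▸ hn c)

/-- An embedding of labelled products is onto if the structure is maximal. -/
lemma surjective_of_isMaximalModel {φ : Sentence L} {P : L.Relations 1} {N' B' : Type u}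
    [L.Structure N'] {F' : N' → B' → Prop} [Nonempty B] (hF : IsLabelling P F)
    (hF' : IsLabelling P F') (hN : IsMaximalModel N φ) (hN' : IsModel N' φ)
    (e : LabProd F ↪[prodLang L] LabProd F') : Function.Surjective e := by
  have h₁ := relMap_one e
  have h₂ := relMap_two e
  have hpt : ∀ n b, ∃ n' b', e (point F n b) = point F' n' b' := fun n b =>
    pt_iff.1 ((h₁ (ptSym L) _).2 (pt_point n b))
  have hidx : ∀ b, ∃ b', e (index F b) = index F' b' := fun b =>
    idx_iff.1 ((h₁ (idxSym L) _).2 (idx_index b))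
  choose g₀ c hg₀ using hpt
  choose s hs using hidx
  let b₀ := Classical.arbitrary B
  -- Preservation of `same` and `proj` makes `e` act coordinatewise, by a map of first factors and
  -- the map `s` of indices.
  have hg : ∀ n b, e (point F n b) = point F' (g₀ n b₀) (s b) := by
    intro n b
    have hsame : Same L (e (point F n b)) (e (point F n b₀)) :=
      (h₂ ProdRel.same _ _).2 (same_point_point.2 rfl)
    have hproj : Proj L (e (point F n b)) (e (index F b)) :=
      (h₂ ProdRel.proj _ _).2 (proj_point_index.2 rfl)
    rw [hg₀, hg₀, same_point_point] at hsame
    rw [hg₀, hs, proj_point_index] at hproj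
    rw [hg₀, hsame, hproj]
  let g : N ↪[L] N' := embeddingOfHolds (fun n => g₀ n b₀)
    (fun n m hnm => by
      have : e (point F n b₀) = e (point F m b₀) := by
        rw [hg, hg]
        exact congrArg₂ _ hnm rfl
      exact (point_inj.1 (e.injective this)).1)
    (fun {k} t x => by
      have : Base L t (e ∘ fun i => point F (x i) b₀) ↔ Base L t (fun i => point F (x i) b₀) :=
        StrongHomClass.map_rel e (ProdRel.base t : (prodLang L).Relations k) _
      rw [base_point (b := fun _ => b₀)] at this
      rw [← this, show (e ∘ fun i => point F (x i) b₀) =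
        fun i => point F' (g₀ (x i) b₀) (s b₀) from funext fun i => hg _ _]
      exact base_point.symm)
  have hgs : Function.Surjective g := hN.2 N' hN' g
  -- Each index `b'` labels some `n'`, and `n'` is the image of an `n` because `g` is onto. The
  -- label of `n` must then be sent to `b'`.
  have hss : Function.Surjective s := by
    intro b'
    obtain ⟨n', hn'⟩ := (hF'.inf b').nonempty
    obtain ⟨n, rfl⟩ := hgs n'
    have hmem : n ∈ predSet P N := (relMap_one g P n).1 (hF'.mem _ _ hn')
    obtain ⟨b, hb⟩ := hF.ex n hmem
    have : Lab L (e (point F n b)) (e (index F b)) :=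
      (h₂ ProdRel.lab _ _).2 (lab_point_index.2 hb)
    rw [hg, hs, lab_point_index] at this
    exact ⟨b, hF'.uniq _ _ _ this hn'⟩
  intro y
  induction y using cases with
  | point n' b' =>
    obtain ⟨n, rfl⟩ := hgs n'
    obtain ⟨b, rfl⟩ := hss b'
    exact ⟨point F n b, hg n b⟩
  | index b' =>
    obtain ⟨b, rfl⟩ := hss b'
    exact ⟨index F b, hs b⟩

end LabProd

/-! ### The sentence `χ`: its models, completeness and maximal models. -/

/-- The sentence whose models are the labelled products of models of `φ` with infinite sets. -/
noncomputable def prodSentence [Countable L.Symbols] (φ : Sentence L) (P : L.Relations 1) :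
    Sentence (prodLang L) :=
  .and (axiomatizable_isProductLike.{u} P).choose (translate φ)

section ProdSentence

variable {φ : Sentence L} {P : L.Relations 1}

lemma LabProd.realize_translate_sentence {N B : Type u} [L.Structure N] [Nonempty B]
    {F : N → B → Prop} :
    (translate φ).Realize (LabProd F) Fin.elim0 ↔ φ.Realize N Fin.elim0 := by
  rw [← realize_translate (F := F) φ Fin.elim0 Fin.elim0]
  exact iff_of_eq (congrArg _ (Subsingleton.elim _ _))

/-- A permutation of the labels lifts to an automorphism of `M` respecting the labelling, and the
two together act on the product. -/
lemma LabProd.isAbsolutelyIndiscernible (hφ : IsComplete.{u} φ) {M C : Type u} [L.Structure M]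
    [Countable M] [Infinite C] {G : M → C → Prop} (hM : IsModel M φ)
    (hind : IsAbsolutelyIndiscernible L (predSet P M)) (hG : IsLabelling P G) :
    IsAbsolutelyIndiscernible (prodLang L) (predSet (idxSym L) (LabProd G)) := by
  refine ⟨Set.infinite_coe_iff.1 (Infinite.of_injective _ (indexEquiv G).injective), fun σ => ?_⟩
  let σ' : Equiv.Perm C := (indexEquiv G).trans (σ.trans (indexEquiv G).symm)
  obtain ⟨g, hg⟩ := hG.exists_equiv hφ hM hM hind hG σ'
  refine ⟨LabProd.equiv g σ' hg, fun x => ?_⟩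
  obtain ⟨b, rfl⟩ := (indexEquiv G).surjective x
  have : ((indexEquiv (L := L) G (σ' b)).1 : LabProd G) = σ (indexEquiv G b) := by simp [σ']
  exact this

variable [Countable L.Symbols]

lemma isModel_prodSentence_iff {X : Type u} [(prodLang L).Structure X] :
    IsModel X (prodSentence.{u} φ P) ↔
      IsProductLike P X ∧ (translate φ).Realize X Fin.elim0 := by
  have := (axiomatizable_isProductLike.{u} P).choose_spec X
  rw [IsModel, prodSentence, Formula.realize_and, this]
  exact ⟨fun h => h.2, fun h => ⟨⟨h.1.idx_inf.nonempty.some⟩, h⟩⟩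

lemma LabProd.isModel_prodSentence {N B : Type u} [L.Structure N] [Infinite B] {F : N → B → Prop}
    (hF : IsLabelling P F) (hN : IsModel N φ) : IsModel (LabProd F) (prodSentence.{u} φ P) :=
  isModel_prodSentence_iff.2 ⟨LabProd.isProductLike hF, LabProd.realize_translate_sentence.2 hN.2⟩

lemma exists_labProd_of_isModel {X : Type u} [(prodLang L).Structure X]
    (hX : IsModel X (prodSentence.{u} φ P)) :
    ∃ (N B : Type u) (_ : L.Structure N) (F : N → B → Prop), Infinite B ∧ IsLabelling P F ∧
      IsModel N φ ∧ Nonempty (LabProd F ≃[prodLang L] X) := by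
  obtain ⟨N, B, _, F, hB, hF, ⟨e⟩⟩ := (isModel_prodSentence_iff.1 hX).1.exists_equiv_labProd
  refine ⟨N, B, _, F, hB, hF, ?_, ⟨e⟩⟩
  have h := (isModel_prodSentence_iff.1 (hX.of_equiv e.symm)).2
  exact ⟨⟨(hF.inf (Classical.arbitrary B)).nonempty.some⟩,
    LabProd.realize_translate_sentence.1 h⟩

/-- All countable models of the product sentence are isomorphic to a given one. -/
lemma nonempty_equiv_labProd (hφ : IsComplete.{u} φ) {M C : Type u} [L.Structure M] [Countable M]
    [Countable C] [Infinite C] {G : M → C → Prop} (hM : IsModel M φ)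
    (hind : IsAbsolutelyIndiscernible L (predSet P M)) (hG : IsLabelling P G)
    {X : Type u} [(prodLang L).Structure X] [Countable X]
    (hX : IsModel X (prodSentence.{u} φ P)) : Nonempty (LabProd G ≃[prodLang L] X) := by
  obtain ⟨N, B, _, F, hB, hF, hN, ⟨e⟩⟩ := exists_labProd_of_isModel hX
  have hc : Countable (LabProd F) := e.injective.countable
  have : Countable B := Function.Injective.countable (f := LabProd.index F) fun _ _ h =>
    LabProd.index_inj.1 h
  have : Countable N := Function.Injective.countable
    (f := fun n => LabProd.point F n (Classical.arbitrary B)) fun _ _ h => (LabProd.point_inj.1 h).1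
  obtain ⟨σ⟩ : Nonempty (B ≃ C) := by rw [← Cardinal.eq, mk_eq_aleph0, mk_eq_aleph0]
  obtain ⟨g, hg⟩ := hF.exists_equiv hφ hN hM hind hG σ
  exact ⟨e.comp (LabProd.equiv g σ hg).symm⟩

lemma isComplete_prodSentence (hφ : IsComplete.{u} φ) {M C : Type u} [L.Structure M] [Countable M]
    [Countable C] [Infinite C] {G : M → C → Prop} (hM : IsModel M φ)
    (hind : IsAbsolutelyIndiscernible L (predSet P M)) (hG : IsLabelling P G) :
    IsComplete.{u} (prodSentence.{u} φ P) := by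
  -- Löwenheim–Skolem for `χ ∧ ψ` gives a countable model, which must be the labelled product of
  -- `M`; hence a sentence true in some model of `χ` is true there.
  have key : ∀ (ψ : Sentence (prodLang L)) (X : Type u) [(prodLang L).Structure X],
      IsModel X (prodSentence.{u} φ P) → ψ.Realize X Fin.elim0 → IsModel (LabProd G) ψ := by
    intro ψ X _ hX hψ
    obtain ⟨Y, _, _, hY₀, hY⟩ := exists_countable_model (M := X)
      (φ := .and (prodSentence.{u} φ P) ψ) ⟨hX.1, (Formula.realize_and _ _ _).2 ⟨hX.2, hψ⟩⟩
    rw [Formula.realize_and] at hY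
    obtain ⟨e⟩ := nonempty_equiv_labProd hφ hM hind hG (X := Y) ⟨hY₀, hY.1⟩
    exact IsModel.of_equiv ⟨hY₀, hY.2⟩ e.symm
  refine ⟨⟨_, _, LabProd.isModel_prodSentence hG hM⟩, fun ψ => ?_⟩
  by_cases h : IsModel (LabProd G) ψ
  · refine .inl fun X _ hX => ⟨hX.1, by_contra fun hψ => ?_⟩
    exact (key ψ.neg X hX hψ).2 h.2
  · exact .inr fun X _ hX hψ => h (key ψ X hX hψ.2)

lemma LabProd.isMaximalModel {N B : Type u} [L.Structure N] [Infinite B] {F : N → B → Prop}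
    (hF : IsLabelling P F) (hN : IsMaximalModel N φ) :
    IsMaximalModel (LabProd F) (prodSentence.{u} φ P) := by
  refine ⟨isModel_prodSentence hF hN.1, fun X _ hX f => ?_⟩
  obtain ⟨N', B', _, F', hB', hF', hN', ⟨e⟩⟩ := exists_labProd_of_isModel hX
  have h := surjective_of_isMaximalModel hF hF' hN hN' (e.symm.toEmbedding.comp f)
  intro x
  obtain ⟨y, hy⟩ := h (e.symm x)
  exact ⟨y, e.symm.injective hy⟩

end ProdSentence

end LOmegaOne

/-! ### Assembling the theorem. -/

theorem mainTheorem9 (κ : Cardinal.{u}) (hκ : LOmegaOne.HomogeneouslyCharacterizable κ) :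
    ∃ (L : FirstOrder.Language.{0, 0}) (χ : LOmegaOne.Sentence L) (B : L.Relations 1),
      Countable L.Symbols ∧
      LOmegaOne.IsReceptive.{u} χ B ∧
      LOmegaOne.HomogeneouslyCharacterizes χ B κ ∧
      ∀ μ : Cardinal.{u}, ℵ₀ ≤ μ → μ ≤ κ →
        ∃ (M : Type u) (_ : L.Structure M),
          LOmegaOne.IsMaximalModel M χ ∧ LOmegaOne.IsOfType M B κ μ := by
  open LOmegaOne in
  obtain ⟨L, φ, P, hL, hφ⟩ := hκ
  obtain ⟨M, _, _, hM, hind⟩ := hφ.indiscernible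
  obtain ⟨N, _, hN, hNκ, hPκ⟩ := hφ.maximal
  -- Countably many labels on the countable model of `φ` give the countable model of `χ`.
  obtain ⟨G, hG⟩ := exists_isLabelling (B := ULift.{u} ℕ) (N := M) P (by
    have : Infinite (predSet P M) := hind.1.to_subtype
    simp)
  have hcomplete := isComplete_prodSentence hφ.complete hM hind hG
  have hindisc : IndiscernibleInCountableModel.{u} (prodSentence.{u} φ P) (idxSym L) :=
    ⟨LabProd G, _, inferInstanceAs (Countable ((M × ULift.{u} ℕ) ⊕ ULift.{u} ℕ)),
      LabProd.isModel_prodSentence hG hM,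
      LabProd.isAbsolutelyIndiscernible hφ.complete hM hind hG⟩
  have hmax : ∀ μ : Cardinal.{u}, ℵ₀ ≤ μ → μ ≤ κ →
      ∃ (X : Type u) (_ : (prodLang L).Structure X),
        IsMaximalModel X (prodSentence.{u} φ P) ∧ IsOfType X (idxSym L) κ μ := by
    intro μ hμ hμκ
    have hB : Infinite μ.out := infinite_iff.2 (by rwa [mk_out])
    have hNinf : Infinite N := infinite_iff.2 (by rw [hNκ]; exact hφ.aleph0_le)
    -- Here the type `(κ, κ)` of the given maximal model matters: `P` is large enough to be labelled
    -- by every `μ ≤ κ`.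
    obtain ⟨F, hF⟩ := exists_isLabelling (B := μ.out) (N := N) P (by rwa [mk_out, hPκ])
    refine ⟨LabProd F, _, LabProd.isMaximalModel hF hN, ?_, ?_⟩
    · rw [LabProd.mk_eq (LabProd.mk_le hF), hNκ]
    · rw [← Cardinal.mk_congr (LabProd.indexEquiv F), mk_out]
  refine ⟨prodLang L, prodSentence.{u} φ P, idxSym L, inferInstance,
    ⟨hcomplete, ⟨ptSym L, projSym L, fun X _ hX =>
      (isModel_prodSentence_iff.1 hX).1.isProjection⟩, hindisc⟩,
    ⟨hφ.aleph0_le, hcomplete, ?_, hindisc, hmax κ hφ.aleph0_le le_rfl⟩, hmax⟩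
  -- The first factor of a model of `χ` is a model of `φ` of the same size.
  rintro ⟨X, _, hX, hXκ⟩
  obtain ⟨N', B', _, F', hB', hF', hN', ⟨e⟩⟩ := exists_labProd_of_isModel hX
  have hle := LabProd.mk_le hF'
  have : Infinite N' := infinite_iff.2 ((aleph0_le_mk B').trans hle)
  exact hφ.no_larger ⟨N', _, hN', by
    rw [← hXκ, ← Cardinal.mk_congr e.toEquiv, LabProd.mk_eq hle]⟩
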